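/- Let $n\ge 0$ and let $A=(X_{ij})_{1\le i,j\le n}$ be a random matrix whose entries are independent, identically distributed real random variables with finite fourth moment. Let $m_r=\mathbb E X_{ij}^r$ denote the moments of the common distribution, put $$\mu_2=m_2-m_1^2,\qquad \mu_3=m_3-3m_1m_2+2m_1^3,\qquad \mu_4=m_4-4m_1m_3+6m_1^2m_2-3m_1^4$$ (the central moments), and assume $\mu_2\neq 0$. Then $f_4(n)=\mathbb E(\det A)^4$ exists (is finite) and $$f_4(n)=(n!)^2\mu_2^{2n}\sum_{j=0}^n\frac1{j!}\left(\frac{\mu_4}{\mu_2^2}-3\right)^j\sum_{i=-2}^4 q_i\binom{n-j+i}{i},$$ where $$q_{-2}=\frac{m_1^4\mu_3^4}{\mu_2^8},\qquad q_{-1}=-\frac{4m_1^3\mu_3^3(\mu_2^2+m_1\mu_3)}{\mu_2^8},\qquad q_0=\frac{6m_1^2\mu_3^2(\mu_2^4+2m_1\mu_2^2\mu_3+m_1^2\mu_3^2-m_1^2\mu_2^3)}{\mu_2^8},$$ $$q_1=\frac{2m_1\left(6m_1^2\mu_2^5\mu_3-2m_1^3\mu_2^6-2\mu_2^6\mu_3+9m_1^3\mu_2^3\mu_3^2-6m_1\mu_2^4\mu_3^2-6m_1^2\mu_2^2\mu_3^3-2m_1^3\mu_3^4\right)}{\mu_2^8},$$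 $$q_2=1+\frac{m_1\left(19m_1^3\mu_2^6-6m_1\mu_2^7-24m_1^2\mu_2^5\mu_3+4\mu_2^6\mu_3-18m_1^3\mu_2^3\mu_3^2+6m_1\mu_2^4\mu_3^2+4m_1^2\mu_2^2\mu_3^3+m_1^3\mu_3^4\right)}{\mu_2^8},$$ $$q_3=\frac{3m_1^2\left(2\mu_2^4-9m_1^2\mu_2^3+4m_1\mu_2^2\mu_3+2m_1^2\mu_3^2\right)}{\mu_2^5},\qquad q_4=\frac{12m_1^4}{\mu_2^2}.$$ Here the determinant of the $0\times 0$ matrix is $1$, $0^0=1$, and by convention $\binom{-2}{-2}=\binom{-1}{-1}=1$, $\binom{-1}{-2}=-1$, and $\binom{k}{-2}=\binom{k}{-1}=0$ for $k\ge 0$. -/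

import Mathlib

open MeasureTheory ProbabilityTheory

noncomputable section

namespace RandomDet

/-- The second central moment, in terms of the raw moments `m 1, m 2`. -/
def mu2 (m : ℕ → ℝ) : ℝ := m 2 - m 1 ^ 2

/-- The third central moment, in terms of the raw moments `m 1, m 2, m 3`. -/
def mu3 (m : ℕ → ℝ) : ℝ := m 3 - 3 * m 1 * m 2 + 2 * m 1 ^ 3

/-- The fourth central moment, in terms of the raw moments `m 1, m 2, m 3, m 4`. -/
def mu4 (m : ℕ → ℝ) : ℝ := m 4 - 4 * m 1 * m 3 + 6 * m 1 ^ 2 * m 2 - 3 * m 1 ^ 4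

/-- The binomial coefficient `a choose b` for integers `a, b`. For `b ≥ 0` it is the usual one.
For negative `b` the convention is `(-2 choose -2) = (-1 choose -1) = 1`, `(-1 choose -2) = -1`,
and `(a choose -2) = (a choose -1) = 0` for `a ≥ 0`; no other arguments are used. -/
def binom (a b : ℤ) : ℤ :=
  if 0 ≤ b then Ring.choose a b.toNat
  else if a = b then 1
  else if a = -1 ∧ b = -2 then -1
  else 0

/-- The coefficients `q₋₂, …, q₄` as rational functions of `m₁`, `μ₂`, `μ₃`
(here `a = m₁`, `s = μ₂`, `c = μ₃`). -/
def qCoeff (a s c : ℝ) : ℤ → ℝ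
  | -2 => a ^ 4 * c ^ 4 / s ^ 8
  | -1 => -(4 * a ^ 3 * c ^ 3 * (s ^ 2 + a * c) / s ^ 8)
  | 0 => 6 * a ^ 2 * c ^ 2 * (s ^ 4 + 2 * a * s ^ 2 * c + a ^ 2 * c ^ 2 - a ^ 2 * s ^ 3) / s ^ 8
  | 1 => 2 * a * (6 * a ^ 2 * s ^ 5 * c - 2 * a ^ 3 * s ^ 6 - 2 * s ^ 6 * c
      + 9 * a ^ 3 * s ^ 3 * c ^ 2 - 6 * a * s ^ 4 * c ^ 2 - 6 * a ^ 2 * s ^ 2 * c ^ 3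
      - 2 * a ^ 3 * c ^ 4) / s ^ 8
  | 2 => 1 + a * (19 * a ^ 3 * s ^ 6 - 6 * a * s ^ 7 - 24 * a ^ 2 * s ^ 5 * c + 4 * s ^ 6 * c
      - 18 * a ^ 3 * s ^ 3 * c ^ 2 + 6 * a * s ^ 4 * c ^ 2 + 4 * a ^ 2 * s ^ 2 * c ^ 3
      + a ^ 3 * c ^ 4) / s ^ 8
  | 3 => 3 * a ^ 2 * (2 * s ^ 4 - 9 * a ^ 2 * s ^ 3 + 4 * a * s ^ 2 * c + 2 * a ^ 2 * c ^ 2)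
      / s ^ 5
  | 4 => 12 * a ^ 4 / s ^ 2
  | _ => 0

/-- The closed formula for the fourth moment of an `n × n` random determinant, as a function of
the raw moments `m r` of the entries. -/
def closedForm (m : ℕ → ℝ) (n : ℕ) : ℝ :=
  (n.factorial : ℝ) ^ 2 * mu2 m ^ (2 * n) *
    ∑ j ∈ Finset.range (n + 1),
      1 / (j.factorial : ℝ) * (mu4 m / mu2 m ^ 2 - 3) ^ j *
        ∑ i ∈ Finset.Icc (-2 : ℤ) 4,
          qCoeff (m 1) (mu2 m) (mu3 m) i * (binom ((n : ℤ) - (j : ℤ) + i) i : ℝ)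

end RandomDet

end

/-! Write `A = Y + m₁ J`, with `Y` centred and `J` the all-ones matrix. As `J` has rank one, `det A
= det Y + m₁ ∑ᵣ det Yᵣ`, where `Yᵣ` is `Y` with row `r` replaced by ones (`det_add_const`). The
fourth power is then a combination of products of four determinants, each with at most one row of
ones.

Expand such a product over quadruples of permutations and take expectations. The rows are
independent, so the result is a `mixedDet`: row `i` contributes a moment tensor in the four column
indices. An ordinary centred row contributes `μ₂² • pairT + (μ₄ - 3μ₂²) • quadT`, the Gaussian
(Wick) part plus the fourth cumulant. A row meeting `J` contributes a tensor of order 3, 2, 1 or 0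
in the remaining indices. Every column is hit once by each of the four permutations, and this
constraint allows each such tensor to be replaced by a combination of `pairT` and `quadT`.

For rows of these two types the value is explicit (`mixedDet_quad_pair`). Choose one of three
pairings for every Gaussian row. The signs cancel, and the compatible quadruples correspond to a
free permutation together with a permutation preserving the pairing labels. Summing over labels is a
Burnside count, so `k` diagonal rows give `n! (n-k)! C(n-k+2, 2)`. By multilinearity a `mixedDet` of
such rows is a linear functional, `wick`, of a product of linear polynomials (`mixedDet_rowT`).

It remains to count the coincidence patterns of the rows of ones (`sum_momentDet`), to expand in the
number `j` of ordinary diagonal rows (`specialSum_eq`), and to compare with the `q_i` for each `N =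
n - j` (`combine_specialTerm`). -/

namespace RandomDet

open Equiv Finset

/-! ### Burnside count of label-preserving permutations -/

section Counting

variable {α κ : Type*} [Fintype α]

lemma exists_perm_comp_eq_iff_map_eq [DecidableEq κ] (f g : α → κ) :
    (∃ π : Perm α, f ∘ π = g) ↔
      (univ : Finset α).val.map f = (univ : Finset α).val.map g := by
  constructor
  · rintro ⟨π, rfl⟩
    conv_lhs => rw [← Multiset.map_univ_val_equiv π, Multiset.map_map]
  · intro h
    have hcard (c : κ) : Fintype.card {a // g a = c} = Fintype.card {a // f a = c} := by
      have := congrArg (Multiset.count c) h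
      rw [Multiset.count_map, Multiset.count_map] at this
      rw [Fintype.card_subtype, Fintype.card_subtype, card_def, card_def, filter_val, filter_val]
      simp only [eq_comm (b := c)]
      exact this.symm
    refine ⟨Equiv.ofFiberEquiv fun c => Fintype.equivOfCardEq (hcard c), ?_⟩
    ext a
    exact Equiv.ofFiberEquiv_map _ a

/-- The number of pairs consisting of a function and a permutation preserving it. -/
lemma sum_card_perm_comp_eq [DecidableEq α] [Fintype κ] [DecidableEq κ] :
    ∑ r : α → κ, Fintype.card {π : Perm α // r ∘ π = r} =
      (Fintype.card α).factorial * Fintype.card (Sym κ (Fintype.card α)) := by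
  classical
  let _ : Fintype (Perm α)ᵈᵐᵃ := Fintype.ofEquiv _ DomMulAct.mk
  -- The multiset of values is a complete orbit invariant, so orbits of functions are counted by
  -- `Sym`.
  let φ : (α → κ) → Sym κ (Fintype.card α) := fun r => ⟨univ.val.map r, by simp⟩
  have hφ (f g : α → κ) : (MulAction.orbitRel (Perm α)ᵈᵐᵃ (α → κ)) f g ↔ φ f = φ g := by
    rw [MulAction.orbitRel_apply, MulAction.mem_orbit_iff,
      show φ f = φ g ↔ univ.val.map f = univ.val.map g from Subtype.ext_iff,
      eq_comm (a := univ.val.map f), ← exists_perm_comp_eq_iff_map_eq]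
    constructor
    · rintro ⟨m, hm⟩
      exact ⟨DomMulAct.mk.symm m, hm⟩
    · rintro ⟨m, hm⟩
      exact ⟨DomMulAct.mk m, hm⟩
  have hsurj : Function.Surjective φ := by
    rintro ⟨s, hs⟩
    induction s using Quotient.inductionOn with
    | h l =>
      have hl : Fintype.card α = l.length := by simpa using hs.symm
      let e : α ≃ Fin l.length := Fintype.equivFinOfCardEq hl
      refine ⟨l.get ∘ e, Subtype.ext ?_⟩
      change univ.val.map (l.get ∘ e) = _
      rw [← Multiset.map_map, Multiset.map_univ_val_equiv e]
      simp [Fin.univ_val_map]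
  have horb : Fintype.card (Quotient (MulAction.orbitRel (Perm α)ᵈᵐᵃ (α → κ))) =
      Fintype.card (Sym κ (Fintype.card α)) := by
    refine Fintype.card_congr (Equiv.ofBijective
      (Quotient.lift φ fun f g h => (hφ f g).1 h) ⟨?_, ?_⟩)
    · intro x y
      induction x using Quotient.inductionOn
      induction y using Quotient.inductionOn
      intro h
      exact Quotient.sound ((hφ _ _).2 h)
    · intro s
      obtain ⟨r, hr⟩ := hsurj s
      exact ⟨Quotient.mk _ r, hr⟩
  have hB := MulAction.sum_card_fixedBy_eq_card_orbits_mul_card_group (Perm α)ᵈᵐᵃ (α → κ)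
  have hG : Fintype.card (Perm α)ᵈᵐᵃ = (Fintype.card α).factorial := by
    rw [← Fintype.card_perm]
    exact Fintype.card_congr DomMulAct.mk.symm
  rw [horb, hG, mul_comm] at hB
  have hfix (π : Perm α) : Fintype.card (MulAction.fixedBy (α → κ) (DomMulAct.mk π)) =
      #{r : α → κ | r ∘ π = r} := by
    rw [← Fintype.card_subtype]
    exact Fintype.card_congr (Equiv.refl _)
  -- Both sides of Burnside's lemma count pairs `(r, π)` with `r ∘ π = r`; only the order of
  -- summation differs.
  rw [← hB, ← Equiv.sum_comp (DomMulAct.mk (M := Perm α))]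
  simp_rw [hfix, Fintype.card_subtype, card_filter]
  exact sum_comm

end Counting

/-! ### Permutations acting on selected fibres -/

section Fiberwise

variable {ι κ : Type*}

/-- The permutation acting as `π` on the fibres of `r` over `p` and trivially elsewhere. -/
def fiberwisePerm (r : ι → κ) (p : κ → Prop) [DecidablePred p] (π : Perm ι)
    (h : ∀ i, r (π i) = r i) : Perm ι where
  toFun i := if p (r i) then π i else i
  invFun i := if p (r i) then π.symm i else i
  left_inv i := by
    by_cases hp : p (r i) <;> simp [hp, h]
  right_inv i := by
    have h' : r (π.symm i) = r i := by rw [← h, π.apply_symm_apply]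
    by_cases hp : p (r i) <;> simp [hp, h']

end Fiberwise

end RandomDet

/-! ### Mixed determinants and pairings of four permutations -/

namespace RandomDet

open Equiv Finset

variable {ι : Type*}

/-- The three ways of pairing off four indices, and (for `none`) the condition that all four
indices agree. -/
def Linked : Option (Fin 3) → (Fin 4 → ι) → Prop
  | none, j => j 0 = j 1 ∧ j 0 = j 2 ∧ j 0 = j 3
  | some 0, j => j 0 = j 1 ∧ j 2 = j 3
  | some 1, j => j 0 = j 2 ∧ j 1 = j 3
  | some 2, j => j 0 = j 3 ∧ j 1 = j 2

instance [DecidableEq ι] (c : Option (Fin 3)) (j : Fin 4 → ι) : Decidable (Linked c j) := by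
  unfold Linked
  split <;> infer_instance

lemma Linked.succ_eq_zero {x : Option (Fin 3)} {j : Fin 4 → ι} (h : Linked x j) {c : Fin 3}
    (hx : x = none ∨ x = some c) : j c.succ = j 0 := by
  obtain rfl | rfl := hx
  · obtain ⟨h1, h2, h3⟩ := h
    match c with
    | 0 => exact h1.symm
    | 1 => exact h2.symm
    | 2 => exact h3.symm
  · match c, h with
    | 0, h => exact h.1.symm
    | 1, h => exact h.1.symm
    | 2, h => exact h.1.symm

lemma Linked.succ_eq_succ {x : Option (Fin 3)} {j : Fin 4 → ι} (h : Linked x j) {c c' : Fin 3}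
    (hc : x ≠ some c) (hc' : x ≠ some c') : j c.succ = j c'.succ := by
  obtain rfl | ⟨d, rfl⟩ := x.eq_none_or_eq_some
  · rw [h.succ_eq_zero (Or.inl rfl), h.succ_eq_zero (Or.inl rfl)]
  · rw [ne_eq, Option.some_inj] at hc hc'
    fin_cases d <;> fin_cases c <;> fin_cases c' <;>
      first
      | rfl
      | exact absurd rfl hc
      | exact absurd rfl hc'
      | exact h.2
      | exact h.2.symm

/-- Permutations that fix and agree according to the labels `r` are the restrictions of a single
label-preserving permutation. -/
lemma exists_fiberwisePerm_eq [Finite ι] (r : ι → Option (Fin 3)) (ρ : Fin 3 → Perm ι)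
    (hfix : ∀ c i, r i = none ∨ r i = some c → ρ c i = i)
    (hagree : ∀ c c' i, r i ≠ some c → r i ≠ some c' → ρ c i = ρ c' i) :
    ∃ (π : Perm ι) (h : ∀ i, r (π i) = r i), (∀ i, r i = none → π i = i) ∧
      ∀ c, ρ c = fiberwisePerm r (fun x => x ≠ none ∧ x ≠ some c) π h := by
  -- If `ρ c` sent `i` to a point of another label `e`, then `ρ e` would agree with `ρ c` at `i`;
  -- but `ρ e` fixes points labelled `e`, so injectivity of `ρ e` forces the image to be `i` itself.
  have hpres (c : Fin 3) (i : ι) : r (ρ c i) = r i := by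
    by_cases hi : r i = none ∨ r i = some c
    · rw [hfix c i hi]
    push Not at hi
    by_cases hx : r (ρ c i) = none ∨ r (ρ c i) = some c
    · rw [(ρ c).injective (hfix c _ hx)]
    push Not at hx
    obtain ⟨e, he⟩ := Option.ne_none_iff_exists'.1 hx.1
    by_cases hd : r i = some e
    · rw [he, hd]
    have h1 : ρ c i = ρ e i := hagree c e i hi.2 hd
    rw [h1] at he ⊢
    rw [(ρ e).injective (hfix e _ (Or.inr he))]
  -- Any `c` other than the label of `i` gives the same value `ρ c i`; `pick` selects one.
  let pick : Option (Fin 3) → Fin 3 := fun x => if x = some 0 then 1 else 0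
  have hpick (x : Option (Fin 3)) : x ≠ some (pick x) := by revert x; decide
  let f : ι → ι := fun i => ρ (pick (r i)) i
  have hf (i : ι) : r (f i) = r i := hpres _ i
  have hinj : Function.Injective f := by
    intro i i' h
    have hr : r i = r i' := by rw [← hf i, ← hf i', h]
    simp only [f, hr] at h
    exact (ρ _).injective h
  refine ⟨Equiv.ofBijective f ((Finite.injective_iff_bijective).1 hinj), hf,
    fun i hi => hfix _ i (Or.inl hi), fun c => ?_⟩
  ext i
  change ρ c i = if r i ≠ none ∧ r i ≠ some c then f i else i
  split_ifs with hc
  · exact hagree _ _ i hc.2 (hpick _)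
  · exact hfix c i (by tauto)

variable [Fintype ι] [DecidableEq ι]

/-- The sum over quadruples of permutations that expands a product of four determinants, with the
product of the four `i`-th rows replaced by a tensor `T i`. -/
noncomputable def mixedDet (T : ι → (Fin 4 → ι) → ℝ) : ℝ :=
  ∑ σ : Fin 4 → Perm ι, (∏ l, ((Perm.sign (σ l) : ℤ) : ℝ)) * ∏ i, T i fun l => σ l i

lemma prod_det_eq_mixedDet (A : Fin 4 → Matrix ι ι ℝ) :
    ∏ l, (A l).det = mixedDet fun i j => ∏ l, A l i (j l) := by
  have h (l : Fin 4) : (A l).det =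
      ∑ σ : Perm ι, ((Perm.sign σ : ℤ) : ℝ) * ∏ i, A l i (σ i) := by
    rw [← Matrix.det_transpose, Matrix.det_apply']
    rfl
  simp_rw [h, mixedDet, Finset.prod_univ_sum, Fintype.piFinset_univ, Finset.prod_mul_distrib]
  exact sum_congr rfl fun σ _ => by rw [prod_comm]

/-- Put `τ = σ 0` and `σ (c+1) = τ * ρ c`. The link conditions say that `ρ c` fixes the rows
labelled `none` or `c` and that the other `ρ`'s agree there. So the `ρ c` are the restrictions of
one label-preserving `π`, and the quadruples are parametrised by `(τ, π)`. -/
lemma mixedDet_linked (r : ι → Option (Fin 3)) :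
    mixedDet (fun i j => if Linked (r i) j then 1 else 0) =
      (Fintype.card ι).factorial *
        Fintype.card {π : Perm ι // r ∘ π = r ∧ ∀ i, r i = none → π i = i} := by
  have hp (π : {π : Perm ι // r ∘ π = r ∧ ∀ i, r i = none → π i = i}) (i : ι) :
      r (π.1 i) = r i := congrFun π.2.1 i
  let fw (π : {π : Perm ι // r ∘ π = r ∧ ∀ i, r i = none → π i = i}) (c : Fin 3) : Perm ι :=
    fiberwisePerm r (fun x => x ≠ none ∧ x ≠ some c) π.1 (hp π)
  have hfw (π) (c : Fin 3) (i : ι) :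
      fw π c i = if r i ≠ none ∧ r i ≠ some c then π.1 i else i := rfl
  let Φ (x : Perm ι × {π : Perm ι // r ∘ π = r ∧ ∀ i, r i = none → π i = i}) :
      Fin 4 → Perm ι := Fin.cons x.1 fun c => x.1 * fw x.2 c
  have hcases (i : ι) : r i = none ∨ r i = some 0 ∨ r i = some 1 ∨ r i = some 2 := by
    generalize r i = x
    revert x
    decide
  have hΦ0 (x) : Φ x 0 = x.1 := rfl
  have hΦ1 (x) : Φ x 1 = x.1 * fw x.2 0 := rfl
  have hΦ2 (x) : Φ x 2 = x.1 * fw x.2 1 := rfl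
  have hΦ3 (x) : Φ x 3 = x.1 * fw x.2 2 := rfl
  have hlinked (x i) : Linked (r i) fun l => Φ x l i := by
    obtain h | h | h | h := hcases i <;>
    simp [h, Linked, hΦ0, hΦ1, hΦ2, hΦ3, hfw]
  have hsign (x) : ∏ l, ((Perm.sign (Φ x l) : ℤ) : ℝ) = 1 := by
    -- A row with a pairing label is moved by exactly two of the three factors, hence the product is
    -- `π²`, which is even.
    have hsq : fw x.2 0 * fw x.2 1 * fw x.2 2 = x.2.1 * x.2.1 := by
      ext i
      have h2 := x.2.2.2 i
      obtain h | h | h | h := hcases i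
      · simp [h, hfw, h2 h]
      all_goals simp [h, hfw, hp]
    have hs : Perm.sign (fw x.2 0) * Perm.sign (fw x.2 1) * Perm.sign (fw x.2 2) = 1 := by
      rw [← Perm.sign_mul, ← Perm.sign_mul, hsq, Perm.sign_mul, Int.units_mul_self]
    have : ∏ l, Perm.sign (Φ x l) = 1 := by
      rw [Fin.prod_univ_four, hΦ0, hΦ1, hΦ2, hΦ3]
      simp only [Perm.sign_mul]
      have h4 := Int.units_mul_self (Perm.sign x.1)
      calc _ = (Perm.sign x.1 * Perm.sign x.1) * (Perm.sign x.1 * Perm.sign x.1) *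
            (Perm.sign (fw x.2 0) * Perm.sign (fw x.2 1) * Perm.sign (fw x.2 2)) := by
              simp only [mul_assoc, mul_comm, mul_left_comm]
        _ = 1 := by rw [hs, h4]; rfl
    have h := congrArg (fun u : ℤˣ => ((u : ℤ) : ℝ)) this
    simpa using h
  have hinj : Function.Injective Φ := by
    rintro ⟨τ, π⟩ ⟨τ', π'⟩ h
    have h0 : τ = τ' := congrFun h 0
    subst h0
    have h1 : fw π 0 = fw π' 0 := mul_left_cancel (congrFun h 1)
    have h2 : fw π 1 = fw π' 1 := mul_left_cancel (congrFun h 2)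
    refine Prod.ext rfl (Subtype.ext (Equiv.ext fun i => ?_))
    have h1i := congrArg (fun f => f i) h1
    have h2i := congrArg (fun f => f i) h2
    simp only [hfw] at h1i h2i
    obtain h | h | h | h := hcases i
    · rw [π.2.2 i h, π'.2.2 i h]
    · simpa [h] using h2i
    · simpa [h] using h1i
    · simpa [h] using h1i
  have hsurj (σ : Fin 4 → Perm ι) (hσ : ∀ i, Linked (r i) fun l => σ l i) : ∃ x, Φ x = σ := by
    obtain ⟨π, h, hn, hρ⟩ := exists_fiberwisePerm_eq r (fun c => (σ 0)⁻¹ * σ c.succ)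
      (fun c i hi => by
        rw [Perm.mul_apply, Perm.inv_eq_iff_eq]
        exact (hσ i).succ_eq_zero hi)
      (fun c c' i hc hc' => by
        rw [Perm.mul_apply, Perm.mul_apply]
        exact congrArg _ ((hσ i).succ_eq_succ hc hc'))
    refine ⟨(σ 0, ⟨π, funext h, hn⟩), funext fun l => ?_⟩
    refine Fin.cases rfl (fun c => ?_) l
    change σ 0 * fw _ c = _
    rw [← mul_right_inj (σ 0)⁻¹, inv_mul_cancel_left]
    exact (hρ c).symm
  calc mixedDet (fun i j => if Linked (r i) j then 1 else 0)
      = ∑ σ : Fin 4 → Perm ι with ∀ i, Linked (r i) fun l => σ l i,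
          ∏ l, ((Perm.sign (σ l) : ℤ) : ℝ) := by
        rw [mixedDet, sum_filter]
        refine sum_congr rfl fun σ _ => ?_
        rw [prod_ite_zero]
        simp
    _ = ∑ x : Perm ι × {π : Perm ι // r ∘ π = r ∧ ∀ i, r i = none → π i = i}, (1 : ℝ) := by
        symm
        refine sum_bij (fun x _ => Φ x) (fun x _ => by simpa using hlinked x)
          (fun x _ y _ h => hinj h) (fun σ hσ => ?_) (fun x _ => (hsign x).symm)
        obtain ⟨x, hx⟩ := hsurj σ (by simpa using hσ)
        exact ⟨x, mem_univ _, hx⟩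
    _ = _ := by
        rw [sum_const, nsmul_one, card_univ, Fintype.card_prod, Fintype.card_perm]
        push_cast
        rfl

end RandomDet

namespace RandomDet

open Equiv Finset Polynomial

/-! ### Evaluation with Gaussian and diagonal rows -/

section Wick

variable {ι : Type*} [DecidableEq ι]

/-- The fourth moment tensor of a standard Gaussian vector. -/
noncomputable def pairT (j : Fin 4 → ι) : ℝ := ∑ c : Fin 3, if Linked (some c) j then 1 else 0

/-- The diagonal tensor. -/
noncomputable def quadT (j : Fin 4 → ι) : ℝ := if Linked none j then 1 else 0

/-- The row tensor `a • pairT + b • quadT` attached to the polynomial `a + b X`. -/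
noncomputable def rowT (p : ℝ[X]) (j : Fin 4 → ι) : ℝ := p.coeff 0 * pairT j + p.coeff 1 * quadT j

lemma rowT_C_add_C_mul_X (a b : ℝ) (j : Fin 4 → ι) :
    rowT (C a + C b * X) j = a * pairT j + b * quadT j := by
  simp only [rowT, coeff_add, coeff_C_mul, coeff_C_zero, coeff_X_zero, coeff_X_one,
    coeff_C_of_ne_zero one_ne_zero]
  ring

variable [Fintype ι]

/-- The mixed determinant with `k` diagonal rows and `n - k` Gaussian rows. -/
noncomputable def wickValue (n k : ℕ) : ℝ := n.factorial * (n - k).factorial * (n - k + 2).choose 2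

/-- The linear functional `X ^ k ↦ wickValue n k`. -/
noncomputable def wick (n : ℕ) : ℝ[X] →ₗ[ℝ] ℝ := lsum fun k => wickValue n k • LinearMap.id

lemma wick_C_mul_X_pow (n k : ℕ) (a : ℝ) : wick n (C a * X ^ k) = a * wickValue n k := by
  rw [wick, lsum_apply, C_mul_X_pow_eq_monomial, sum_monomial_index _ _ (by simp)]
  simp [mul_comm]

lemma card_perm_extend_eq (K : Finset ι) (r : {i // i ∉ K} → Fin 3) (r' : ι → Option (Fin 3))
    (hr : ∀ i (h : i ∉ K), r' i = some (r ⟨i, h⟩)) (hK : ∀ i ∈ K, r' i = none) :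
    Fintype.card {π : Perm ι // r' ∘ π = r' ∧ ∀ i, r' i = none → π i = i} =
      Fintype.card {π : Perm {i // i ∉ K} // r ∘ π = r} := by
  have hnone (i : ι) : r' i = none ↔ i ∈ K := by
    refine ⟨fun h => ?_, hK i⟩
    by_contra hi
    simp [hr i hi] at h
  symm
  refine Fintype.card_of_bijective
    (f := fun π => ⟨Perm.ofSubtype (p := (· ∉ K)) π.1, ?_, ?_⟩) ⟨?_, ?_⟩
  · funext i
    by_cases hi : i ∈ K
    · rw [Function.comp_apply, Perm.ofSubtype_apply_of_not_mem (p := (· ∉ K)) _ (by simpa using hi)]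
    · rw [Function.comp_apply, Perm.ofSubtype_apply_of_mem (p := (· ∉ K)) _ hi,
        hr _ (π.1 ⟨i, hi⟩).2, hr i hi]
      exact congrArg some (congrFun π.2 ⟨i, hi⟩)
  · intro i hi
    exact Perm.ofSubtype_apply_of_not_mem (p := (· ∉ K)) _ (by simpa using (hnone i).1 hi)
  · intro π π' h
    exact Subtype.ext (Perm.ofSubtype_injective (congrArg Subtype.val h))
  · rintro ⟨π, h1, h2⟩
    have hiff (i : ι) : π i ∉ K ↔ i ∉ K := by
      rw [← hnone, ← hnone, ← Function.comp_apply (f := r'), h1]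
    refine ⟨⟨π.subtypePerm hiff, ?_⟩, Subtype.ext ?_⟩
    · funext i
      have := congrFun h1 i
      rw [Function.comp_apply, hr _ ((hiff i).2 i.2), hr _ i.2] at this
      exact Option.some_injective _ this
    · exact Perm.ofSubtype_subtypePerm hiff fun i hi => by
        by_contra hK'
        exact hi (h2 i ((hnone i).2 (by simpa using hK')))

/-- Expanding each `pairT` into its three pairings gives a sum over labellings of the complement of
`K` of `n!` times a stabiliser. Burnside turns this into `(n-k)!` times the number of multisets of
size `n-k` in three labels. -/
lemma mixedDet_quad_pair (K : Finset ι) :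
    mixedDet (fun i (j : Fin 4 → ι) => if i ∈ K then quadT j else pairT j) =
      wickValue (Fintype.card ι) #K := by
  let t (i : ι) : Finset (Option (Fin 3)) := if i ∈ K then {none} else univ.map .some
  have ht (i : ι) (j : Fin 4 → ι) : (if i ∈ K then quadT j else pairT j) =
      ∑ c ∈ t i, if Linked c j then (1 : ℝ) else 0 := by
    by_cases hi : i ∈ K
    · simp only [t, hi, if_true, quadT, sum_singleton]
    · simp only [t, hi, if_false, pairT, sum_map, Function.Embedding.some_apply]
  have hexp : mixedDet (fun i (j : Fin 4 → ι) => if i ∈ K then quadT j else pairT j) =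
      ∑ r ∈ Fintype.piFinset t,
        mixedDet (fun i (j : Fin 4 → ι) => if Linked (r i) j then 1 else 0) := by
    simp_rw [mixedDet, ht, prod_univ_sum, mul_sum]
    exact sum_comm
  let ext (r : {i // i ∉ K} → Fin 3) (i : ι) : Option (Fin 3) :=
    if h : i ∉ K then some (r ⟨i, h⟩) else none
  have hext (r i) (h : i ∉ K) : ext r i = some (r ⟨i, h⟩) := dif_pos h
  have hext' (r i) (h : i ∈ K) : ext r i = none := dif_neg (by simpa using h)
  have hsum : ∑ r ∈ Fintype.piFinset t,
        Fintype.card {π : Perm ι // r ∘ π = r ∧ ∀ i, r i = none → π i = i} =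
      ∑ r : {i // i ∉ K} → Fin 3, Fintype.card {π : Perm {i // i ∉ K} // r ∘ π = r} := by
    symm
    refine sum_bij (fun r _ => ext r) (fun r _ => ?_) (fun r _ r' _ h => ?_) (fun r hr => ?_)
      (fun r _ => (card_perm_extend_eq K r (ext r) (hext r) (hext' r)).symm)
    · rw [Fintype.mem_piFinset]
      intro i
      by_cases hi : i ∈ K
      · simp [t, hi, hext' r i hi]
      · simp [t, hi, hext r i hi]
    · funext i
      have := congrFun h i
      rw [hext r i i.2, hext r' i i.2] at this
      exact Option.some_injective _ this
    · rw [Fintype.mem_piFinset] at hr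
      have hsome (i : {i // i ∉ K}) : ∃ c, r i = some c := by
        have := hr i
        simp only [t, i.2, if_false, mem_map, mem_univ, true_and] at this
        obtain ⟨c, hc⟩ := this
        exact ⟨c, hc.symm⟩
      choose c hc using hsome
      refine ⟨c, mem_univ _, funext fun i => ?_⟩
      by_cases hi : i ∈ K
      · have := hr i
        simp only [t, hi, if_true, mem_singleton] at this
        rw [hext' c i hi, this]
      · rw [hext c i hi, ← hc]
  have hcard : Fintype.card {i // i ∉ K} = Fintype.card ι - #K := by
    rw [Fintype.card_subtype_compl, Fintype.card_coe]
  rw [hexp, sum_congr rfl fun r _ => mixedDet_linked r, ← mul_sum, ← Nat.cast_sum, hsum,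
    sum_card_perm_comp_eq, hcard, Sym.card_sym_eq_choose, Fintype.card_fin, wickValue,
    show 3 + (Fintype.card ι - #K) - 1 = (Fintype.card ι - #K) + 2 by omega,
    Nat.choose_symm_add]
  push_cast
  ring

/-- Multilinearity in the rows: choosing the set `K` of diagonal rows mirrors choosing the factors
that contribute `X`, and the mixed determinant depends only on `#K`. The degree bound is needed
because `rowT` reads only the first two coefficients. -/
lemma mixedDet_rowT (p : ι → ℝ[X]) (hp : ∀ i, (p i).natDegree ≤ 1) :
    mixedDet (fun i (j : Fin 4 → ι) => rowT (p i) j) = wick (Fintype.card ι) (∏ i, p i) := by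
  have hprod : ∏ i, p i = ∑ K ∈ univ.powerset,
      C ((∏ i ∈ K, (p i).coeff 1) * ∏ i ∈ univ \ K, (p i).coeff 0) * X ^ #K := by
    rw [prod_congr rfl fun i _ => eq_X_add_C_of_natDegree_le_one (hp i), prod_add]
    refine sum_congr rfl fun K _ => ?_
    rw [prod_mul_distrib, prod_const, C_mul, map_prod, map_prod]
    ring
  have hrow (σ : Fin 4 → Perm ι) : ∏ i, rowT (p i) (fun l => σ l i) = ∑ K ∈ univ.powerset,
      (∏ i ∈ K, (p i).coeff 1) * (∏ i ∈ univ \ K, (p i).coeff 0) *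
        ∏ i, if i ∈ K then quadT (fun l => σ l i) else pairT (fun l => σ l i) := by
    simp_rw [rowT, add_comm _ (coeff _ 1 * _), prod_add, prod_mul_distrib]
    refine sum_congr rfl fun K _ => ?_
    rw [prod_ite, filter_mem_eq_inter, univ_inter, filter_notMem_eq_sdiff]
    ring
  rw [hprod, map_sum]
  simp_rw [wick_C_mul_X_pow, ← mixedDet_quad_pair, mixedDet, hrow, mul_sum]
  rw [sum_comm]
  refine sum_congr rfl fun K _ => sum_congr rfl fun σ _ => ?_
  ring

end Wick

end RandomDet

namespace RandomDet

open Equiv Finset Polynomial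

/-! ### Replacing one row tensor by another -/

section RowReduction

variable {ι : Type*}

/-- The four indices can be split into two pairs of equal ones. -/
def Paired (j : Fin 4 → ι) : Prop := ∃ c : Fin 3, Linked (some c) j

/-- If `σ l` took the value `x` at a row `i ≠ r`, some other `σ l'` would take it there too,
although it already does so at `r`. -/
lemma eq_of_linked_of_forall_ne (σ : Fin 4 → Perm ι) (r x : ι) (l : Fin 4)
    (h : ∀ i, i ≠ r → ∃ l' ≠ l, σ l' i = σ l i) (hr : ∀ l' ≠ l, σ l' r = x) : σ l r = x := by
  by_cases hi : (σ l).symm x = r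
  · rw [← hi, apply_symm_apply]
  · obtain ⟨l', hl', he⟩ := h _ hi
    rw [apply_symm_apply, ← hr l' hl', (σ l').apply_eq_iff_eq, hr l' hl'] at he
    exact absurd he hi

variable [DecidableEq ι]

lemma even_card_of_paired {j : Fin 4 → ι} (h : Paired j) (k : ι) : Even #{l | j l = k} := by
  rw [card_filter, Fin.sum_univ_four]
  obtain ⟨c, hc⟩ := h
  match c, hc with
  | 0, ⟨h1, h2⟩ =>
    exact ⟨(if j 1 = k then 1 else 0) + if j 3 = k then 1 else 0, by rw [h1, h2]; ring⟩
  | 1, ⟨h1, h2⟩ =>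
    exact ⟨(if j 2 = k then 1 else 0) + if j 3 = k then 1 else 0, by rw [h1, h2]; ring⟩
  | 2, ⟨h1, h2⟩ =>
    exact ⟨(if j 3 = k then 1 else 0) + if j 2 = k then 1 else 0, by rw [h1, h2]; ring⟩

lemma paired_of_even_card {j : Fin 4 → ι} (h : ∀ k, Even #{l | j l = k}) : Paired j := by
  simp only [card_filter, Fin.sum_univ_four] at h
  by_cases h1 : j 1 = j 0
  · refine ⟨0, h1.symm, ?_⟩
    by_contra h3
    have := h (j 2)
    rw [h1, if_neg (Ne.symm h3), if_pos rfl] at this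
    split_ifs at this <;> exact absurd this (by decide)
  by_cases h2 : j 2 = j 0
  · refine ⟨1, h2.symm, ?_⟩
    have := h (j 1)
    rw [h2, if_neg (Ne.symm h1), if_pos rfl] at this
    by_contra h3
    rw [if_neg (Ne.symm h3)] at this
    exact absurd this (by decide)
  have h0 := h (j 0)
  rw [if_pos rfl, if_neg h1, if_neg h2] at h0
  by_cases h3 : j 3 = j 0
  · refine ⟨2, h3.symm, ?_⟩
    have := h (j 1)
    rw [h3, if_neg (Ne.symm h1), if_pos rfl] at this
    by_contra h4
    rw [if_neg (Ne.symm h4)] at this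
    exact absurd this (by decide)
  · rw [if_neg h3] at h0
    exact absurd h0 (by decide)

variable [Fintype ι]

/-- Parity: each column `k` is hit four times in all, and a paired row hits it an even number of
times, so the remaining row does as well. -/
lemma paired_of_forall_ne (σ : Fin 4 → Perm ι) (r : ι)
    (h : ∀ i, i ≠ r → Paired fun l => σ l i) : Paired fun l => σ l r := by
  refine paired_of_even_card fun k => ?_
  have htot : ∑ i, #{l | σ l i = k} = 4 := by
    simp_rw [card_filter]
    rw [sum_comm]
    simp [← Perm.eq_inv_iff_eq]
  rw [← add_sum_erase univ _ (mem_univ r)] at htot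
  have heven : Even (∑ i ∈ univ.erase r, #{l | σ l i = k}) :=
    even_sum _ fun i hi => even_card_of_paired (h i (ne_of_mem_erase hi)) k
  have h4 : Even (#{l | σ l r = k} + ∑ i ∈ univ.erase r, #{l | σ l i = k}) := by
    rw [htot]
    decide
  exact (Nat.even_add.1 h4).2 heven

/-- Quadruples on which another row vanishes contribute nothing, so a row tensor matters only on
index tuples compatible with the supports of the other rows. -/
lemma mixedDet_congr_row {T : ι → (Fin 4 → ι) → ℝ} {r : ι} {f g : (Fin 4 → ι) → ℝ}
    (h : ∀ σ : Fin 4 → Perm ι, (∀ i, i ≠ r → T i (fun l => σ l i) ≠ 0) →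
      f (fun l => σ l r) = g fun l => σ l r) :
    mixedDet (Function.update T r f) = mixedDet (Function.update T r g) := by
  refine sum_congr rfl fun σ _ => congrArg _ ?_
  by_cases hσ : ∀ i, i ≠ r → T i (fun l => σ l i) ≠ 0
  · refine prod_congr rfl fun i _ => ?_
    by_cases hi : i = r
    · subst hi
      simpa using h σ hσ
    · simp [hi]
  · push Not at hσ
    obtain ⟨i, hi, h0⟩ := hσ
    rw [prod_eq_zero (mem_univ i) (by simpa [hi] using h0),
      prod_eq_zero (mem_univ i) (by simpa [hi] using h0)]

lemma mixedDet_congr_of_paired {T : ι → (Fin 4 → ι) → ℝ} {r : ι} {f g : (Fin 4 → ι) → ℝ}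
    (hT : ∀ i, i ≠ r → ∀ j, T i j ≠ 0 → Paired j) (h : ∀ j, Paired j → f j = g j) :
    mixedDet (Function.update T r f) = mixedDet (Function.update T r g) :=
  mixedDet_congr_row fun σ hσ =>
    h _ (paired_of_forall_ne σ r fun i hi => hT i hi _ (hσ i hi))

/-- The tensor requiring the three indices other than the `l`-th to agree. -/
noncomputable def triT (l : Fin 4) (j : Fin 4 → ι) : ℝ :=
  if ∀ l', l' ≠ l → ∀ l'', l'' ≠ l → j l' = j l'' then 1 else 0

/-- When the `l`-th index is matched in every other row, agreement of the three indices in row `r`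
forces the fourth to agree too, by `eq_of_linked_of_forall_ne`. -/
lemma mixedDet_update_triT {T : ι → (Fin 4 → ι) → ℝ} {r : ι} (l : Fin 4) (a : ℝ)
    (hT : ∀ i, i ≠ r → ∀ j, T i j ≠ 0 → ∃ l' ≠ l, j l' = j l) :
    mixedDet (Function.update T r fun j => a * triT l j) =
      mixedDet (Function.update T r fun j => a * quadT j) := by
  refine mixedDet_congr_row fun σ hσ => ?_
  have hl : ∃ m : Fin 4, m ≠ l := exists_ne l
  obtain ⟨m, hm⟩ := hl
  have key : (∀ l', l' ≠ l → ∀ l'', l'' ≠ l → σ l' r = σ l'' r) ↔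
      Linked none fun l => σ l r := by
    constructor
    · intro h
      have h1 := eq_of_linked_of_forall_ne σ r (σ m r) l (fun i hi => hT i hi _ (hσ i hi))
        fun l' hl' => h l' hl' m hm
      have h2 (l' : Fin 4) : σ l' r = σ m r := by
        by_cases hl' : l' = l
        · rw [hl', h1]
        · exact h l' hl' m hm
      simp [Linked, h2]
    · rintro ⟨h1, h2, h3⟩
      have h4 (l' : Fin 4) : σ l' r = σ 0 r := by
        match l' with
        | 0 => rfl
        | 1 => exact h1.symm
        | 2 => exact h2.symm
        | 3 => exact h3.symm
      intro l' _ l'' _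
      rw [h4 l', h4 l'']
  simp only [triT, quadT, key]

lemma prod_update_row (T : ι → (Fin 4 → ι) → ℝ) (r : ι) (f : (Fin 4 → ι) → ℝ)
    (σ : Fin 4 → Perm ι) :
    ∏ i, Function.update T r f i (fun l => σ l i) =
      f (fun l => σ l r) * ∏ i ∈ univ.erase r, T i fun l => σ l i := by
  rw [← mul_prod_erase univ _ (mem_univ r), Function.update_self]
  exact congrArg _ (prod_congr rfl fun i hi => by
    rw [Function.update_of_ne (ne_of_mem_erase hi)])

lemma mixedDet_update_smul (T : ι → (Fin 4 → ι) → ℝ) (r : ι) (a : ℝ) (f : (Fin 4 → ι) → ℝ) :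
    mixedDet (Function.update T r fun j => a * f j) = a * mixedDet (Function.update T r f) := by
  rw [mixedDet, mixedDet, mul_sum]
  refine sum_congr rfl fun σ _ => ?_
  rw [prod_update_row, prod_update_row]
  ring

lemma mixedDet_update_add (T : ι → (Fin 4 → ι) → ℝ) (r : ι) (f g : (Fin 4 → ι) → ℝ) :
    mixedDet (Function.update T r fun j => f j + g j) =
      mixedDet (Function.update T r f) + mixedDet (Function.update T r g) := by
  simp only [mixedDet, ← sum_add_distrib]
  refine sum_congr rfl fun σ _ => ?_
  rw [prod_update_row, prod_update_row, prod_update_row]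
  ring

lemma mixedDet_comp_perm (T : ι → (Fin 4 → ι) → ℝ) (π : Perm (Fin 4)) :
    mixedDet (fun i j => T i (j ∘ π)) = mixedDet T := by
  rw [mixedDet, mixedDet, ← Equiv.sum_comp (Equiv.arrowCongr π (Equiv.refl (Perm ι)))]
  refine sum_congr rfl fun σ _ => ?_
  congr 1
  · rw [← Equiv.prod_comp π]
    simp
  · refine prod_congr rfl fun i _ => congrArg _ (funext fun l => ?_)
    simp

/-- Invariance of a row tensor under permutations of the four factors. -/
def SymmT (f : (Fin 4 → ι) → ℝ) : Prop := ∀ (π : Perm (Fin 4)) (j : Fin 4 → ι), f (j ∘ π) = f j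

/-- The tensor of one of the three pairings. -/
noncomputable def linkT (c : Option (Fin 3)) (j : Fin 4 → ι) : ℝ := if Linked c j then 1 else 0

/-- Permuting the four factors leaves the symmetric rows unchanged and carries the three pairings
into one another, so each accounts for a third of `pairT`. -/
lemma mixedDet_update_linkT {T : ι → (Fin 4 → ι) → ℝ} {r : ι} (hT : ∀ i, i ≠ r → SymmT (T i)) :
    3 * mixedDet (Function.update T r (linkT (some 0))) =
      mixedDet (Function.update T r pairT) := by
  have hperm (π : Perm (Fin 4)) (f : (Fin 4 → ι) → ℝ) :
      mixedDet (Function.update T r fun j => f (j ∘ π)) = mixedDet (Function.update T r f) := by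
    rw [← mixedDet_comp_perm (Function.update T r f) π]
    congr 1
    funext i
    by_cases hi : i = r
    · subst hi
      simp
    · funext j
      simp [hi, hT i hi π j]
  have h1 : mixedDet (Function.update T r (linkT (some 1))) =
      mixedDet (Function.update T r (linkT (some 0))) := by
    rw [← hperm (swap 1 2)]
    congr 2
  have h2 : mixedDet (Function.update T r (linkT (some 2))) =
      mixedDet (Function.update T r (linkT (some 0))) := by
    rw [← hperm (swap 1 3)]
    congr 2
    funext j
    exact if_congr (by simp [Linked, swap_apply_of_ne_of_ne, eq_comm]) rfl rfl
  have hp : (pairT : (Fin 4 → ι) → ℝ) =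
      fun j => linkT (some 0) j + (linkT (some 1) j + linkT (some 2) j) := by
    funext j
    rw [pairT, Fin.sum_univ_three, add_assoc]
    rfl
  rw [hp, mixedDet_update_add, mixedDet_update_add, h1, h2]
  ring

/-- Exchanging rows `r` and `r'` in the last two permutations only costs two cancelling signs. It
moves the condition `j 2 = j 3` to row `r'`, leaving row `r` free. -/
lemma mixedDet_swap_rows (T : ι → (Fin 4 → ι) → ℝ) {r r' : ι} (h : r ≠ r') :
    mixedDet (Function.update (Function.update T r fun j => if j 2 = j 3 then 1 else 0) r'
        fun j => if j 0 = j 1 then 1 else 0) =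
      mixedDet (Function.update (Function.update T r fun _ => 1) r' (linkT (some 0))) := by
  let e : Perm (Fin 4 → Perm ι) := Equiv.piCongrRight fun l =>
    if l = 2 ∨ l = 3 then Equiv.mulRight (swap r r') else Equiv.refl _
  have h0 (σ) : e σ 0 = σ 0 := rfl
  have h1 (σ) : e σ 1 = σ 1 := rfl
  have h2 (σ) : e σ 2 = σ 2 * swap r r' := rfl
  have h3 (σ) : e σ 3 = σ 3 * swap r r' := rfl
  rw [mixedDet, mixedDet, ← Equiv.sum_comp e]
  refine sum_congr rfl fun σ _ => ?_
  congr 1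
  · rw [Fin.prod_univ_four, Fin.prod_univ_four, h0, h1, h2, h3]
    simp [Perm.sign_swap h]
  have hr : r ∈ univ.erase r' := by simpa using h
  have hne {i : ι} (hi : i ∈ (univ.erase r').erase r) : i ≠ r ∧ i ≠ r' := by simpa using hi
  rw [prod_update_row, prod_update_row, ← mul_prod_erase _ _ hr, ← mul_prod_erase _ _ hr,
    Function.update_self, Function.update_self]
  have hrest : ∏ i ∈ (univ.erase r').erase r,
        Function.update T r (fun j => if j 2 = j 3 then 1 else 0) i (fun l => e σ l i) =
      ∏ i ∈ (univ.erase r').erase r, Function.update T r (fun _ => 1) i (fun l => σ l i) := by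
    refine prod_congr rfl fun i hi => ?_
    rw [Function.update_of_ne (hne hi).1, Function.update_of_ne (hne hi).1]
    refine congrArg _ (funext fun l => ?_)
    match l with
    | 0 => rw [h0]
    | 1 => rw [h1]
    | 2 => rw [h2, Perm.mul_apply, swap_apply_of_ne_of_ne (hne hi).1 (hne hi).2]
    | 3 => rw [h3, Perm.mul_apply, swap_apply_of_ne_of_ne (hne hi).1 (hne hi).2]
  rw [hrest]
  simp only [h0, h1, h2, h3, linkT, Perm.mul_apply, swap_apply_left, Linked]
  split_ifs <;> simp_all

end RowReduction

end RandomDet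

namespace RandomDet

open Equiv Finset Polynomial

/-! ### Moment tensors of centred rows -/

section MomentTensor

variable {ι : Type*} [DecidableEq ι] [Fintype ι]

/-- The moment tensor of a vector with independent entries having moments `M`, restricted to the
factors in `B`. -/
noncomputable def momT (M : ℕ → ℝ) (B : Finset (Fin 4)) (j : Fin 4 → ι) : ℝ :=
  ∏ k, M #{l ∈ B | j l = k}

lemma momT_eq_zero {M : ℕ → ℝ} (h1 : M 1 = 0) {B : Finset (Fin 4)} {j : Fin 4 → ι} {l : Fin 4}
    (hl : l ∈ B) (h : ∀ l' ∈ B, l' ≠ l → j l' ≠ j l) : momT M B j = 0 := by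
  refine prod_eq_zero (mem_univ (j l)) ?_
  have : {l' ∈ B | j l' = j l} = {l} := by
    ext l'
    rw [mem_filter, mem_singleton]
    constructor
    · rintro ⟨hB, he⟩
      by_contra hne
      exact h l' hB hne he
    · rintro rfl
      exact ⟨hl, rfl⟩
  rw [this, card_singleton, h1]

lemma momT_of_forall_eq {M : ℕ → ℝ} (h0 : M 0 = 1) {B : Finset (Fin 4)} {j : Fin 4 → ι} {x : ι}
    (h : ∀ l ∈ B, j l = x) : momT M B j = M #B := by
  rw [momT, prod_eq_single x]
  · rw [filter_true_of_mem h]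
  · intro k _ hk
    rw [filter_false_of_mem fun l hl => by rw [h l hl]; exact hk.symm, card_empty, h0]
  · simp

lemma momT_of_pairs {M : ℕ → ℝ} (h0 : M 0 = 1) {j : Fin 4 → ι} {x y : ι} (hxy : x ≠ y)
    (hx : #{l | j l = x} = 2) (hy : #{l | j l = y} = 2) (h : ∀ l, j l = x ∨ j l = y) :
    momT M univ j = M 2 * M 2 := by
  rw [momT, prod_eq_mul x y hxy]
  · rw [hx, hy]
  · rintro k _ ⟨hkx, hky⟩
    rw [filter_false_of_mem fun l _ => by
      rintro rfl
      rcases h l with h | h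
      · exact hkx h
      · exact hky h, card_empty, h0]
  · simp
  · simp

/-- With vanishing first moment only two patterns survive: two distinct pairs, with value `M 2 ^ 2`,
and all indices equal, with value `M 4`. At the latter `pairT` equals 3, hence the coefficient `M 4
- 3 * M 2 ^ 2`. -/
lemma momT_univ {M : ℕ → ℝ} (h0 : M 0 = 1) (h1 : M 1 = 0) :
    (momT M univ : (Fin 4 → ι) → ℝ) = rowT (C (M 2 ^ 2) + C (M 4 - 3 * M 2 ^ 2) * X) := by
  funext j
  have hz (l : Fin 4) (h : ∀ l', l' ≠ l → j l' ≠ j l) : momT M univ j = 0 :=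
    momT_eq_zero h1 (mem_univ l) fun l' _ => h l'
  have hp {x y : ι} (hxy : x ≠ y) (hx : #{l | j l = x} = 2) (hy : #{l | j l = y} = 2)
    (h : ∀ l, j l = x ∨ j l = y) := momT_of_pairs (M := M) h0 hxy hx hy h
  rw [rowT_C_add_C_mul_X, pairT, Fin.sum_univ_three, quadT]
  by_cases e1 : j 1 = j 0 <;> by_cases e2 : j 2 = j 0 <;> by_cases e3 : j 3 = j 0
  · rw [momT_of_forall_eq h0 (x := j 0) (by simp [Fin.forall_fin_succ, e1, e2, e3])]
    simp [Linked, e1, e2, e3]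
    ring
  · rw [hz 3 (by simp [Fin.forall_fin_succ, e1, e2, Ne.symm e3])]
    simp [Linked, e1, e2, Ne.symm e3]
  · rw [hz 2 (by simp [Fin.forall_fin_succ, e1, e3, Ne.symm e2])]
    simp [Linked, e1, e3, e2, Ne.symm e2]
  · by_cases e : j 2 = j 3
    · rw [hp (x := j 0) (y := j 3) (Ne.symm e3)
        (by rw [card_filter, Fin.sum_univ_four]; simp [e, e1, e3])
        (by rw [card_filter, Fin.sum_univ_four]; simp [e, e1, Ne.symm e3])
        (by simp [Fin.forall_fin_succ, e, e1])]
      simp [Linked, e, e1, Ne.symm e3]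
      ring
    · rw [hz 3 (by simp [Fin.forall_fin_succ, e1, e, Ne.symm e3])]
      simp [Linked, e, e1, Ne.symm e3, Ne.symm e2]
  · rw [hz 1 (by simp [Fin.forall_fin_succ, e2, e3, Ne.symm e1])]
    simp [Linked, e2, e3, e1, Ne.symm e1]
  · by_cases e : j 1 = j 3
    · rw [hp (x := j 0) (y := j 3) (Ne.symm e3)
        (by rw [card_filter, Fin.sum_univ_four]; simp [e, e2, e3])
        (by rw [card_filter, Fin.sum_univ_four]; simp [e, e2, Ne.symm e3])
        (by simp [Fin.forall_fin_succ, e, e2])]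
      simp [Linked, e, e2, Ne.symm e3]
      ring
    · rw [hz 3 (by simp [Fin.forall_fin_succ, e2, e, Ne.symm e3])]
      simp [Linked, e, e2, Ne.symm e3, Ne.symm e1]
  · by_cases e : j 1 = j 2
    · rw [hp (x := j 0) (y := j 2) (Ne.symm e2)
        (by rw [card_filter, Fin.sum_univ_four]; simp [e, e2, e3])
        (by rw [card_filter, Fin.sum_univ_four]; simp [e, e3, Ne.symm e2])
        (by simp [Fin.forall_fin_succ, e, e3])]
      simp [Linked, e, e3, Ne.symm e2, e2]
      ring
    · rw [hz 2 (by simp [Fin.forall_fin_succ, e3, e, Ne.symm e2])]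
      simp [Linked, e, e3, Ne.symm e2, Ne.symm e1]
  · rw [hz 0 (by simp [Fin.forall_fin_succ, e1, e2, e3])]
    simp [Linked, Ne.symm e1, Ne.symm e2, Ne.symm e3]

lemma momT_compl {M : ℕ → ℝ} (h0 : M 0 = 1) (h1 : M 1 = 0) (l : Fin 4) :
    (momT M {l}ᶜ : (Fin 4 → ι) → ℝ) = fun j => M 3 * triT l j := by
  have h3 : #({l}ᶜ : Finset (Fin 4)) = 3 := by simp [card_compl]
  obtain ⟨a, b, c, hab, hac, hbc, hB⟩ := card_eq_three.1 h3
  have hl (l' : Fin 4) : l' ≠ l ↔ l' = a ∨ l' = b ∨ l' = c := by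
    have := congrArg (l' ∈ ·) hB
    simpa using this
  funext j
  rw [triT]
  split_ifs with h
  · rw [momT_of_forall_eq h0 (x := j a), h3, mul_one]
    intro l' hl'
    exact h l' (by simpa using hl') a ((hl a).2 (Or.inl rfl))
  · rw [hB, mul_zero]
    by_cases e1 : j a = j b
    · have e2 : j c ≠ j b := by
        intro e2
        refine h fun l' hl' l'' hl'' => ?_
        have key (m : Fin 4) (hm : m ≠ l) : j m = j b := by
          rcases (hl m).1 hm with rfl | rfl | rfl
          · exact e1
          · rfl
          · exact e2
        rw [key l' hl', key l'' hl'']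
      exact momT_eq_zero h1 (l := c) (by simp) (by simp [e1, e2.symm])
    · by_cases e2 : j c = j a
      · exact momT_eq_zero h1 (l := b) (by simp) (by simp [e1, e2])
      · exact momT_eq_zero h1 (l := a) (by simp) (by simp [Ne.symm e1, e2])

lemma momT_pair {M : ℕ → ℝ} (h0 : M 0 = 1) (h1 : M 1 = 0) {a b : Fin 4} (hab : a ≠ b) :
    (momT M {a, b} : (Fin 4 → ι) → ℝ) = fun j => M 2 * if j a = j b then 1 else 0 := by
  funext j
  split_ifs with h
  · rw [momT_of_forall_eq h0 (x := j b) (by simp [h]), card_pair hab, mul_one]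
  · rw [momT_eq_zero h1 (l := a) (by simp) (by simp [Ne.symm h]), mul_zero]

lemma momT_singleton {M : ℕ → ℝ} (h1 : M 1 = 0) (l : Fin 4) :
    (momT M {l} : (Fin 4 → ι) → ℝ) = fun _ => 0 :=
  funext fun _ => momT_eq_zero h1 (mem_singleton_self l) (by simp)

lemma momT_empty {M : ℕ → ℝ} (h0 : M 0 = 1) :
    (momT M ∅ : (Fin 4 → ι) → ℝ) = fun _ => 1 := by
  funext j
  simp [momT, h0]

/-- Moment tensors are visibly symmetric, and `pairT`, `quadT` are moment tensors: of the standard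
Gaussian moments `1, 0, 1, 0, 3`, and of a formal sequence with `M 2 = 0` and `M 4 = 1`. -/
lemma symmT_rowT (p : ℝ[X]) : SymmT (rowT p : (Fin 4 → ι) → ℝ) := by
  have hmom (M : ℕ → ℝ) : SymmT (momT M univ : (Fin 4 → ι) → ℝ) := by
    intro π j
    refine prod_congr rfl fun k _ => ?_
    congr 1
    simp_rw [card_filter]
    exact Equiv.sum_comp π fun l => if j l = k then 1 else 0
  let M₁ : ℕ → ℝ := fun k => if k = 0 ∨ k = 2 then 1 else if k = 4 then 3 else 0
  let M₂ : ℕ → ℝ := fun k => if k = 0 ∨ k = 4 then 1 else 0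
  have e₁ : momT M₁ univ = (pairT : (Fin 4 → ι) → ℝ) := by
    rw [momT_univ (by simp [M₁]) (by simp [M₁])]
    funext j
    rw [rowT_C_add_C_mul_X]
    simp [M₁]
  have e₂ : momT M₂ univ = (quadT : (Fin 4 → ι) → ℝ) := by
    rw [momT_univ (by simp [M₂]) (by simp [M₂])]
    funext j
    rw [rowT_C_add_C_mul_X]
    simp [M₂]
  intro π j
  rw [rowT, rowT, ← e₁, ← e₂, hmom M₁, hmom M₂]

end MomentTensor

end RandomDet

namespace RandomDet

open Equiv Finset Polynomial

/-! ### Special rows reduced to polynomial rows -/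

section Evaluation

variable {ι : Type*}

/-- On the support of the tensor `f`, the `l`-th index agrees with another one. -/
def LinkedAt (l : Fin 4) (f : (Fin 4 → ι) → ℝ) : Prop := ∀ j, f j ≠ 0 → ∃ l' ≠ l, j l' = j l

lemma Paired.exists_ne {j : Fin 4 → ι} (h : Paired j) (l : Fin 4) : ∃ l' ≠ l, j l' = j l := by
  obtain ⟨c, hc⟩ := h
  match c, hc, l with
  | 0, ⟨h1, h2⟩, 0 => exact ⟨1, by decide, h1.symm⟩
  | 0, ⟨h1, h2⟩, 1 => exact ⟨0, by decide, h1⟩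
  | 0, ⟨h1, h2⟩, 2 => exact ⟨3, by decide, h2.symm⟩
  | 0, ⟨h1, h2⟩, 3 => exact ⟨2, by decide, h2⟩
  | 1, ⟨h1, h2⟩, 0 => exact ⟨2, by decide, h1.symm⟩
  | 1, ⟨h1, h2⟩, 1 => exact ⟨3, by decide, h2.symm⟩
  | 1, ⟨h1, h2⟩, 2 => exact ⟨0, by decide, h1⟩
  | 1, ⟨h1, h2⟩, 3 => exact ⟨1, by decide, h2⟩
  | 2, ⟨h1, h2⟩, 0 => exact ⟨3, by decide, h1.symm⟩
  | 2, ⟨h1, h2⟩, 1 => exact ⟨2, by decide, h2.symm⟩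
  | 2, ⟨h1, h2⟩, 2 => exact ⟨1, by decide, h2⟩
  | 2, ⟨h1, h2⟩, 3 => exact ⟨0, by decide, h1⟩

variable [DecidableEq ι]

lemma paired_of_rowT_ne_zero {p : ℝ[X]} {j : Fin 4 → ι} (h : rowT p j ≠ 0) : Paired j := by
  by_contra hp
  have h1 (c : Fin 3) : ¬ Linked (some c) j := fun hc => hp ⟨c, hc⟩
  have h2 : ¬ Linked none j := fun hc => hp ⟨0, hc.1, by rw [← hc.2.1, hc.2.2]⟩
  exact h (by simp [rowT, pairT, quadT, h1, h2])

lemma linkedAt_rowT (l : Fin 4) (p : ℝ[X]) : LinkedAt l (rowT p : (Fin 4 → ι) → ℝ) :=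
  fun _ h => (paired_of_rowT_ne_zero h).exists_ne l

lemma linkedAt_triT {l m : Fin 4} (h : l ≠ m) (a : ℝ) :
    LinkedAt l fun j : Fin 4 → ι => a * triT m j := by
  intro j hj
  have : ∀ l', l' ≠ m → ∀ l'', l'' ≠ m → j l' = j l'' := by
    by_contra hn
    exact hj (by dsimp only; rw [triT, if_neg hn, mul_zero])
  obtain ⟨l', h1, h2⟩ : ∃ l', l' ≠ l ∧ l' ≠ m := by
    clear this hj
    revert l m
    decide
  exact ⟨l', h1, this l' h2 l h⟩

lemma linkedAt_two (a : ℝ) : LinkedAt 2 fun j : Fin 4 → ι => a * if j 2 = j 3 then 1 else 0 := by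
  intro j hj
  by_contra h
  push Not at h
  exact hj (by dsimp only; rw [if_neg (h 3 (by decide)).symm, mul_zero])

lemma linkedAt_three (a : ℝ) :
    LinkedAt 3 fun j : Fin 4 → ι => a * if j 2 = j 3 then 1 else 0 := by
  intro j hj
  by_contra h
  push Not at h
  exact hj (by dsimp only; rw [if_neg (h 2 (by decide)), mul_zero])

lemma LinkedAt.update {l : Fin 4} {T : ι → (Fin 4 → ι) → ℝ} (hT : ∀ i, LinkedAt l (T i)) (r : ι)
    {f : (Fin 4 → ι) → ℝ} (hf : LinkedAt l f) (i : ι) : LinkedAt l (Function.update T r f i) := by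
  by_cases hi : i = r
  · rwa [hi, Function.update_self]
  · rw [Function.update_of_ne hi]
    exact hT i

lemma update_rowT (p : ι → ℝ[X]) (r : ι) (q : ℝ[X]) :
    Function.update (fun i => (rowT (p i) : (Fin 4 → ι) → ℝ)) r (rowT q) =
      fun i => rowT (Function.update p r q i) :=
  (Function.comp_update rowT p r q).symm

lemma quadT_eq_rowT : (quadT : (Fin 4 → ι) → ℝ) = rowT X := by
  funext j
  simp [rowT]

lemma pairT_eq_rowT : (pairT : (Fin 4 → ι) → ℝ) = rowT 1 := by
  funext j
  simp [rowT, coeff_one]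

variable [Fintype ι]

lemma mixedDet_triT_row {T : ι → (Fin 4 → ι) → ℝ} {r : ι} {l : Fin 4} {a : ℝ}
    (hT : ∀ i, LinkedAt l (T i)) :
    mixedDet (Function.update T r fun j => a * triT l j) =
      a * mixedDet (Function.update T r (rowT X)) := by
  rw [mixedDet_update_triT l a fun i _ => hT i, mixedDet_update_smul, quadT_eq_rowT]

lemma mixedDet_linkT_row (p : ι → ℝ[X]) (r : ι) :
    3 * mixedDet (Function.update (fun i => rowT (p i)) r (linkT (some 0))) =
      mixedDet fun i => rowT (Function.update p r 1 i) := by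
  rw [mixedDet_update_linkT fun i _ => symmT_rowT (p i), pairT_eq_rowT, update_rowT]

/-- Since the other rows are paired, so is row `r`, and for a paired tuple `j 2 = j 3` already
implies `j 0 = j 1`. Symmetry among the pairings then gives the factor 3. -/
lemma mixedDet_pair_row (p : ι → ℝ[X]) (r : ι) (a : ℝ) :
    3 * mixedDet (Function.update (fun i => rowT (p i)) r
        fun j => a * if j 2 = j 3 then 1 else 0) =
      a * mixedDet fun i => rowT (Function.update p r 1 i) := by
  rw [← mixedDet_linkT_row, mixedDet_update_smul, mul_left_comm]
  congr 2
  refine mixedDet_congr_of_paired (fun i _ j => paired_of_rowT_ne_zero) fun j hj => ?_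
  refine if_congr ?_ rfl rfl
  obtain ⟨c, hc⟩ := hj
  refine ⟨fun h => ⟨?_, h⟩, fun h => h.2⟩
  match c, hc with
  | 0, hc => exact hc.1
  | 1, hc => rw [hc.1, hc.2, h]
  | 2, hc => rw [hc.1, hc.2, h]

/-- On paired tuples `pairT - 2 * quadT` is constantly 1: it is `3 - 2` when all indices agree, and
`1 - 0` otherwise. -/
lemma mixedDet_free_row {T : ι → (Fin 4 → ι) → ℝ} {r : ι}
    (hT : ∀ i, i ≠ r → ∀ j, T i j ≠ 0 → Paired j) :
    mixedDet (Function.update T r fun _ => 1) =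
      mixedDet (Function.update T r (rowT (1 - C 2 * X))) := by
  refine mixedDet_congr_of_paired hT fun j hj => ?_
  have : rowT (1 - C 2 * X) j = pairT j - 2 * quadT j := by
    have := rowT_C_add_C_mul_X 1 (-2) j
    rw [show (1 - C 2 * X : ℝ[X]) = C 1 + C (-2) * X by simp; ring, this]
    ring
  rw [this, pairT, quadT, Fin.sum_univ_three]
  obtain ⟨c, hc⟩ := hj
  by_cases hn : Linked none j
  · obtain ⟨h1, h2, h3⟩ := hn
    simp [Linked, ← h1, ← h2, ← h3]
    norm_num
  · match c, hc with
    | 0, ⟨h1, h2⟩ =>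
      have h3 : j 1 ≠ j 3 := fun h => hn ⟨h1, by rw [h2, h1, h], by rw [h1, h]⟩
      simp [Linked, h1, h2, h3]
    | 1, ⟨h1, h2⟩ =>
      have h3 : j 2 ≠ j 3 := fun h => hn ⟨by rw [h1, h2, h], h1, by rw [h1, h]⟩
      simp [Linked, h1, h2, h3]
    | 2, ⟨h1, h2⟩ =>
      have h3 : j 3 ≠ j 2 := fun h => hn ⟨by rw [h1, h2, h], by rw [h1, h], h1⟩
      simp [Linked, h1, h2, h3, Ne.symm h3]

lemma mixedDet_eq_zero {T : ι → (Fin 4 → ι) → ℝ} (r : ι) (h : T r = fun _ => 0) :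
    mixedDet T = 0 :=
  sum_eq_zero fun σ _ => by rw [prod_eq_zero (mem_univ r) (by rw [h]), mul_zero]

end Evaluation

end RandomDet

namespace RandomDet

open Equiv Finset Polynomial

/-! ### Moments for each coincidence pattern of the rows of ones -/

section Patterns

variable {ι : Type*} [DecidableEq ι] [Fintype ι]

/-- The polynomial describing the fourth moment tensor of a centred vector with independent
entries having moments `M`. -/
noncomputable def rowPoly (M : ℕ → ℝ) : ℝ[X] := C (M 2 ^ 2) + C (M 4 - 3 * M 2 ^ 2) * X

/-- The expectation of a product of four determinants of a random matrix with independent entries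
having moments `M`, where in each determinant at most one row is replaced by ones. -/
noncomputable def momentDet (M : ℕ → ℝ) (a b c d : Option ι) : ℝ :=
  mixedDet fun i => momT M {l | ![a, b, c, d] l ≠ some i}

lemma natDegree_rowPoly (M : ℕ → ℝ) : (rowPoly M).natDegree ≤ 1 := by
  unfold rowPoly
  compute_degree

omit [Fintype ι] in
lemma natDegree_update_le {p : ι → ℝ[X]} {q : ℝ[X]} (hp : ∀ i, (p i).natDegree ≤ 1) (r : ι)
    (hq : q.natDegree ≤ 1) (i : ι) : (Function.update p r q i).natDegree ≤ 1 := by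
  by_cases hi : i = r
  · rwa [hi, Function.update_self]
  · rw [Function.update_of_ne hi]
    exact hp i

omit [Fintype ι] in
lemma prod_update_erase {p : ι → ℝ[X]} {q : ℝ[X]} {s : Finset ι} {r : ι} (hr : r ∈ s) :
    ∏ i ∈ s, Function.update p r q i = q * ∏ i ∈ s.erase r, p i := by
  rw [prod_update_of_mem hr, sdiff_singleton_eq_erase]

lemma mixedDet_zero_special (M : ℕ → ℝ) :
    mixedDet (fun _ : ι => rowT (rowPoly M)) =
      wick (Fintype.card ι) (rowPoly M ^ Fintype.card ι) := by
  rw [mixedDet_rowT _ fun _ => natDegree_rowPoly M, prod_const, card_univ]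

lemma mixedDet_one_special (M : ℕ → ℝ) (r : ι) {q : ℝ[X]} (hq : q.natDegree ≤ 1) :
    mixedDet (fun i => rowT (Function.update (fun _ : ι => rowPoly M) r q i)) =
      wick (Fintype.card ι) (q * rowPoly M ^ (Fintype.card ι - 1)) := by
  rw [mixedDet_rowT _ (natDegree_update_le (fun _ => natDegree_rowPoly M) r hq),
    prod_update_erase (mem_univ r), prod_const, card_erase_of_mem (mem_univ r), card_univ]

lemma mixedDet_two_special (M : ℕ → ℝ) {r r' : ι} (h : r ≠ r') {q q' : ℝ[X]}
    (hq : q.natDegree ≤ 1) (hq' : q'.natDegree ≤ 1) :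
    mixedDet (fun i => rowT (Function.update (Function.update (fun _ : ι => rowPoly M) r q)
        r' q' i)) = wick (Fintype.card ι) (q' * (q * rowPoly M ^ (Fintype.card ι - 2))) := by
  have hr : r ∈ univ.erase r' := mem_erase.2 ⟨h, mem_univ r⟩
  rw [mixedDet_rowT _ (natDegree_update_le (natDegree_update_le (fun _ => natDegree_rowPoly M)
      r hq) r' hq'), prod_update_erase (mem_univ r'), prod_update_erase hr, prod_const,
    card_erase_of_mem hr, card_erase_of_mem (mem_univ r'), card_univ, Nat.sub_sub]

lemma mixedDet_three_special (M : ℕ → ℝ) {r r' r'' : ι} (h : r ≠ r') (h' : r ≠ r'')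
    (h'' : r' ≠ r'') {q q' q'' : ℝ[X]}
    (hq : q.natDegree ≤ 1) (hq' : q'.natDegree ≤ 1) (hq'' : q''.natDegree ≤ 1) :
    mixedDet (fun i => rowT (Function.update (Function.update (Function.update
        (fun _ : ι => rowPoly M) r q) r' q') r'' q'' i)) =
      wick (Fintype.card ι) (q'' * (q' * (q * rowPoly M ^ (Fintype.card ι - 3)))) := by
  have hr' : r' ∈ univ.erase r'' := mem_erase.2 ⟨h'', mem_univ r'⟩
  have hr : r ∈ (univ.erase r'').erase r' := mem_erase.2 ⟨h, mem_erase.2 ⟨h', mem_univ r⟩⟩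
  rw [mixedDet_rowT _ (natDegree_update_le (natDegree_update_le (natDegree_update_le
      (fun _ => natDegree_rowPoly M) r hq) r' hq') r'' hq''), prod_update_erase (mem_univ r''),
    prod_update_erase hr', prod_update_erase hr, prod_const, card_erase_of_mem hr,
    card_erase_of_mem hr', card_erase_of_mem (mem_univ r''), card_univ, Nat.sub_sub, Nat.sub_sub]

lemma mixedDet_four_special (M : ℕ → ℝ) {a b c d : ι} (hab : a ≠ b) (hac : a ≠ c) (had : a ≠ d)
    (hbc : b ≠ c) (hbd : b ≠ d) (hcd : c ≠ d) :
    mixedDet (fun i => rowT (Function.update (Function.update (Function.update (Function.update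
        (fun _ : ι => rowPoly M) a X) b X) c X) d X i)) =
      wick (Fintype.card ι) (X ^ 4 * rowPoly M ^ (Fintype.card ι - 4)) := by
  have hX : (X : ℝ[X]).natDegree ≤ 1 := natDegree_X_le
  have hc : c ∈ univ.erase d := by simp [*]
  have hb : b ∈ (univ.erase d).erase c := by simp [*]
  have ha : a ∈ ((univ.erase d).erase c).erase b := by simp [*]
  rw [mixedDet_rowT _ (natDegree_update_le (natDegree_update_le (natDegree_update_le
      (natDegree_update_le (fun _ => natDegree_rowPoly M) a hX) b hX) c hX) d hX),
    prod_update_erase (mem_univ d), prod_update_erase hc, prod_update_erase hb,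
    prod_update_erase ha, prod_const, card_erase_of_mem ha, card_erase_of_mem hb,
    card_erase_of_mem hc, card_erase_of_mem (mem_univ d), card_univ, Nat.sub_sub, Nat.sub_sub,
    Nat.sub_sub]
  congr 1
  ring

variable {M : ℕ → ℝ} (h0 : M 0 = 1) (h1 : M 1 = 0)

include h0 h1

lemma momT_univ_eq_rowPoly : (momT M univ : (Fin 4 → ι) → ℝ) = rowT (rowPoly M) :=
  momT_univ h0 h1

lemma momentDet_none :
    momentDet (ι := ι) M none none none none =
      wick (Fintype.card ι) (rowPoly M ^ Fintype.card ι) := by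
  rw [← mixedDet_zero_special, momentDet]
  congr 1
  funext i
  rw [← momT_univ_eq_rowPoly h0 h1]
  congr 1

lemma momentDet_one (r : ι) :
    momentDet M (some r) none none none =
      M 3 * wick (Fintype.card ι) (X * rowPoly M ^ (Fintype.card ι - 1)) := by
  have hT : momentDet M (some r) none none none = mixedDet (Function.update
      (fun _ => rowT (rowPoly M)) r fun j => M 3 * triT 0 j) := by
    rw [momentDet]
    congr 1
    funext i
    by_cases hi : i = r
    · subst hi
      rw [Function.update_self, ← momT_compl h0 h1]
      congr 1
      ext l
      fin_cases l <;> simp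
    · rw [Function.update_of_ne hi, ← momT_univ_eq_rowPoly h0 h1]
      congr 1
      ext l
      fin_cases l <;> simp [Ne.symm hi]
  rw [hT, mixedDet_triT_row fun i => linkedAt_rowT 0 _, update_rowT,
    mixedDet_one_special M r natDegree_X_le]

lemma momentDet_two (r : ι) :
    3 * momentDet M (some r) (some r) none none =
      M 2 * wick (Fintype.card ι) (rowPoly M ^ (Fintype.card ι - 1)) := by
  have hT : momentDet M (some r) (some r) none none = mixedDet (Function.update
      (fun _ => rowT (rowPoly M)) r fun j => M 2 * if j 2 = j 3 then 1 else 0) := by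
    rw [momentDet]
    congr 1
    funext i
    by_cases hi : i = r
    · subst hi
      rw [Function.update_self, ← momT_pair h0 h1 (by decide)]
      congr 1
      ext l
      fin_cases l <;> simp
    · rw [Function.update_of_ne hi, ← momT_univ_eq_rowPoly h0 h1]
      congr 1
      ext l
      fin_cases l <;> simp [Ne.symm hi]
  rw [hT, mixedDet_pair_row, mixedDet_one_special M r (by simp), one_mul]

/-- The `triT` rows can be made diagonal one after another: a row `triT m` still matches the index
`l ≠ m`, and a row already replaced matches every index. The longer patterns below use the same
succession. -/
lemma momentDet_one_one {r r' : ι} (h : r ≠ r') :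
    momentDet M (some r) (some r') none none =
      M 3 ^ 2 * wick (Fintype.card ι) (X ^ 2 * rowPoly M ^ (Fintype.card ι - 2)) := by
  have hT : momentDet M (some r) (some r') none none = mixedDet (Function.update (Function.update
      (fun _ => rowT (rowPoly M)) r fun j => M 3 * triT 0 j) r' fun j => M 3 * triT 1 j) := by
    rw [momentDet]
    congr 1
    funext i
    by_cases hi : i = r
    · subst hi
      rw [Function.update_of_ne h, Function.update_self, ← momT_compl h0 h1]
      congr 1
      ext l
      fin_cases l <;> simp [Ne.symm h]
    by_cases hi' : i = r'
    · subst hi'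
      rw [Function.update_self, ← momT_compl h0 h1]
      congr 1
      ext l
      fin_cases l <;> simp [h]
    · rw [Function.update_of_ne hi', Function.update_of_ne hi, ← momT_univ_eq_rowPoly h0 h1]
      congr 1
      ext l
      fin_cases l <;> simp [Ne.symm hi, Ne.symm hi']
  rw [hT, mixedDet_triT_row (.update (fun i => linkedAt_rowT 1 _) r
      (linkedAt_triT (by decide) _)), Function.update_comm h,
    mixedDet_triT_row (.update (fun i => linkedAt_rowT 0 _) r' (linkedAt_rowT 0 _)),
    update_rowT, update_rowT, mixedDet_two_special M h.symm natDegree_X_le natDegree_X_le,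
    ← mul_assoc, ← mul_assoc, ← pow_two, ← pow_two]

omit h0 in
lemma momentDet_three (r : ι) : momentDet M (some r) (some r) (some r) none = 0 := by
  refine mixedDet_eq_zero r ?_
  rw [← momT_singleton h1 3]
  congr 1
  ext l
  fin_cases l <;> simp

omit h0 in
lemma momentDet_three_one {r r' : ι} (h : r ≠ r') :
    momentDet M (some r) (some r) (some r) (some r') = 0 := by
  refine mixedDet_eq_zero r ?_
  rw [← momT_singleton h1 3]
  congr 1
  ext l
  fin_cases l <;> simp [h.symm]

lemma momentDet_four (r : ι) :
    momentDet M (some r) (some r) (some r) (some r) =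
      wick (Fintype.card ι) ((1 - C 2 * X) * rowPoly M ^ (Fintype.card ι - 1)) := by
  have hT : momentDet M (some r) (some r) (some r) (some r) = mixedDet (Function.update
      (fun _ => rowT (rowPoly M)) r fun _ => 1) := by
    rw [momentDet]
    congr 1
    funext i
    by_cases hi : i = r
    · subst hi
      rw [Function.update_self, ← momT_empty h0]
      congr 1
      ext l
      fin_cases l <;> simp
    · rw [Function.update_of_ne hi, ← momT_univ_eq_rowPoly h0 h1]
      congr 1
      ext l
      fin_cases l <;> simp [Ne.symm hi]
  rw [hT, mixedDet_free_row fun i _ j => paired_of_rowT_ne_zero, update_rowT,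
    mixedDet_one_special M r (by compute_degree)]

/-- The `triT` row has to go first: the condition `j 2 = j 3` matches index 2, whereas the reduction
of the pair row needs all other rows paired. -/
lemma momentDet_two_one {r r' : ι} (h : r ≠ r') :
    3 * momentDet M (some r) (some r) (some r') none =
      M 2 * M 3 * wick (Fintype.card ι) (X * rowPoly M ^ (Fintype.card ι - 2)) := by
  have hT : momentDet M (some r) (some r) (some r') none = mixedDet (Function.update
      (Function.update (fun _ => rowT (rowPoly M)) r fun j => M 2 * if j 2 = j 3 then 1 else 0) r'
      fun j => M 3 * triT 2 j) := by
    rw [momentDet]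
    congr 1
    funext i
    by_cases hi : i = r
    · subst hi
      rw [Function.update_of_ne h, Function.update_self, ← momT_pair h0 h1 (by decide)]
      congr 1
      ext l
      fin_cases l <;> simp [Ne.symm h]
    by_cases hi' : i = r'
    · subst hi'
      rw [Function.update_self, ← momT_compl h0 h1]
      congr 1
      ext l
      fin_cases l <;> simp [h]
    · rw [Function.update_of_ne hi', Function.update_of_ne hi, ← momT_univ_eq_rowPoly h0 h1]
      congr 1
      ext l
      fin_cases l <;> simp [Ne.symm hi, Ne.symm hi']
  rw [hT, mixedDet_triT_row (.update (fun i => linkedAt_rowT 2 _) r (linkedAt_two _)),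
    Function.update_comm h, update_rowT, mul_left_comm, mixedDet_pair_row,
    mixedDet_two_special M h.symm natDegree_X_le (by simp), one_mul]
  ring

lemma momentDet_one_one_one {a b c : ι} (hab : a ≠ b) (hac : a ≠ c) (hbc : b ≠ c) :
    momentDet M (some a) (some b) (some c) none =
      M 3 ^ 3 * wick (Fintype.card ι) (X ^ 3 * rowPoly M ^ (Fintype.card ι - 3)) := by
  have hT : momentDet M (some a) (some b) (some c) none = mixedDet (Function.update
      (Function.update (Function.update (fun _ => rowT (rowPoly M)) a fun j => M 3 * triT 0 j) b
      fun j => M 3 * triT 1 j) c fun j => M 3 * triT 2 j) := by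
    rw [momentDet]
    congr 1
    funext i
    by_cases ha : i = a
    · subst ha
      rw [Function.update_of_ne hac, Function.update_of_ne hab, Function.update_self,
        ← momT_compl h0 h1]
      congr 1
      ext l
      fin_cases l <;> simp [hab.symm, hac.symm]
    by_cases hb : i = b
    · subst hb
      rw [Function.update_of_ne hbc, Function.update_self, ← momT_compl h0 h1]
      congr 1
      ext l
      fin_cases l <;> simp [hab, hbc.symm]
    by_cases hc : i = c
    · subst hc
      rw [Function.update_self, ← momT_compl h0 h1]
      congr 1
      ext l
      fin_cases l <;> simp [hac, hbc]
    · rw [Function.update_of_ne hc, Function.update_of_ne hb, Function.update_of_ne ha,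
        ← momT_univ_eq_rowPoly h0 h1]
      congr 1
      ext l
      fin_cases l <;> simp [Ne.symm ha, Ne.symm hb, Ne.symm hc]
  rw [hT, mixedDet_triT_row (.update (.update (fun i => linkedAt_rowT 2 _) a
      (linkedAt_triT (by decide) _)) b (linkedAt_triT (by decide) _)),
    Function.update_comm hbc, mixedDet_triT_row (.update (.update (fun i => linkedAt_rowT 1 _) a
      (linkedAt_triT (by decide) _)) c (linkedAt_rowT 1 _)),
    Function.update_comm hac, Function.update_comm hab, mixedDet_triT_row (.update (.update
      (fun i => linkedAt_rowT 0 _) c (linkedAt_rowT 0 _)) b (linkedAt_rowT 0 _)),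
    update_rowT, update_rowT, update_rowT, mixedDet_three_special M hbc.symm hac.symm hab.symm
      natDegree_X_le natDegree_X_le natDegree_X_le]
  ring_nf

lemma momentDet_two_one_one {a b c : ι} (hab : a ≠ b) (hac : a ≠ c) (hbc : b ≠ c) :
    3 * momentDet M (some a) (some a) (some b) (some c) =
      M 2 * M 3 ^ 2 * wick (Fintype.card ι) (X ^ 2 * rowPoly M ^ (Fintype.card ι - 3)) := by
  have hT : momentDet M (some a) (some a) (some b) (some c) = mixedDet (Function.update
      (Function.update (Function.update (fun _ => rowT (rowPoly M)) a
      fun j => M 2 * if j 2 = j 3 then 1 else 0) b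
      fun j => M 3 * triT 2 j) c fun j => M 3 * triT 3 j) := by
    rw [momentDet]
    congr 1
    funext i
    by_cases ha : i = a
    · subst ha
      rw [Function.update_of_ne hac, Function.update_of_ne hab, Function.update_self,
        ← momT_pair h0 h1 (by decide)]
      congr 1
      ext l
      fin_cases l <;> simp [hab.symm, hac.symm]
    by_cases hb : i = b
    · subst hb
      rw [Function.update_of_ne hbc, Function.update_self, ← momT_compl h0 h1]
      congr 1
      ext l
      fin_cases l <;> simp [hab, hbc.symm]
    by_cases hc : i = c
    · subst hc
      rw [Function.update_self, ← momT_compl h0 h1]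
      congr 1
      ext l
      fin_cases l <;> simp [hac, hbc]
    · rw [Function.update_of_ne hc, Function.update_of_ne hb, Function.update_of_ne ha,
        ← momT_univ_eq_rowPoly h0 h1]
      congr 1
      ext l
      fin_cases l <;> simp [Ne.symm ha, Ne.symm hb, Ne.symm hc]
  rw [hT, mixedDet_triT_row (.update (.update (fun i => linkedAt_rowT 3 _) a
      (linkedAt_three _)) b (linkedAt_triT (by decide) _)),
    Function.update_comm hbc, mixedDet_triT_row (.update (.update (fun i => linkedAt_rowT 2 _) a
      (linkedAt_two _)) c (linkedAt_rowT 2 _)),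
    Function.update_comm hac, Function.update_comm hab, update_rowT, update_rowT,
    mul_left_comm, mul_left_comm 3, mixedDet_pair_row,
    mixedDet_three_special M hbc.symm hac.symm hab.symm natDegree_X_le natDegree_X_le (by simp)]
  ring_nf

lemma momentDet_one_one_one_one {a b c d : ι} (hab : a ≠ b) (hac : a ≠ c) (had : a ≠ d)
    (hbc : b ≠ c) (hbd : b ≠ d) (hcd : c ≠ d) :
    momentDet M (some a) (some b) (some c) (some d) =
      M 3 ^ 4 * wick (Fintype.card ι) (X ^ 4 * rowPoly M ^ (Fintype.card ι - 4)) := by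
  have hT : momentDet M (some a) (some b) (some c) (some d) = mixedDet (Function.update
      (Function.update (Function.update (Function.update (fun _ => rowT (rowPoly M)) a
      fun j => M 3 * triT 0 j) b fun j => M 3 * triT 1 j) c fun j => M 3 * triT 2 j) d
      fun j => M 3 * triT 3 j) := by
    rw [momentDet]
    congr 1
    funext i
    by_cases ha : i = a
    · subst ha
      rw [Function.update_of_ne had, Function.update_of_ne hac, Function.update_of_ne hab,
        Function.update_self, ← momT_compl h0 h1]
      congr 1
      ext l
      fin_cases l <;> simp [hab.symm, hac.symm, had.symm]
    by_cases hb : i = b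
    · subst hb
      rw [Function.update_of_ne hbd, Function.update_of_ne hbc, Function.update_self,
        ← momT_compl h0 h1]
      congr 1
      ext l
      fin_cases l <;> simp [hab, hbc.symm, hbd.symm]
    by_cases hc : i = c
    · subst hc
      rw [Function.update_of_ne hcd, Function.update_self, ← momT_compl h0 h1]
      congr 1
      ext l
      fin_cases l <;> simp [hac, hbc, hcd.symm]
    by_cases hd : i = d
    · subst hd
      rw [Function.update_self, ← momT_compl h0 h1]
      congr 1
      ext l
      fin_cases l <;> simp [had, hbd, hcd]
    · rw [Function.update_of_ne hd, Function.update_of_ne hc, Function.update_of_ne hb,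
        Function.update_of_ne ha, ← momT_univ_eq_rowPoly h0 h1]
      congr 1
      ext l
      fin_cases l <;> simp [Ne.symm ha, Ne.symm hb, Ne.symm hc, Ne.symm hd]
  rw [hT, mixedDet_triT_row (.update (.update (.update (fun i => linkedAt_rowT 3 _) a
      (linkedAt_triT (by decide) _)) b (linkedAt_triT (by decide) _)) c
      (linkedAt_triT (by decide) _)),
    Function.update_comm hcd, mixedDet_triT_row (.update (.update (.update
      (fun i => linkedAt_rowT 2 _) a (linkedAt_triT (by decide) _)) b
      (linkedAt_triT (by decide) _)) d (linkedAt_rowT 2 _)),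
    Function.update_comm hbd, Function.update_comm hbc, mixedDet_triT_row (.update (.update
      (.update (fun i => linkedAt_rowT 1 _) a (linkedAt_triT (by decide) _)) d
      (linkedAt_rowT 1 _)) c (linkedAt_rowT 1 _)),
    Function.update_comm had, Function.update_comm hac, Function.update_comm hab,
    mixedDet_triT_row (.update (.update (.update (fun i => linkedAt_rowT 0 _) d
      (linkedAt_rowT 0 _)) c (linkedAt_rowT 0 _)) b (linkedAt_rowT 0 _)),
    update_rowT, update_rowT, update_rowT, update_rowT,
    mixedDet_four_special M hcd.symm hbd.symm had.symm hbc.symm hac.symm hab.symm]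
  ring

/-- Neither pair row is reducible by itself, as the other is not supported on paired tuples.
`mixedDet_swap_rows` trades them for a free row and a full pairing, which can be evaluated. -/
lemma momentDet_two_two {r r' : ι} (h : r ≠ r') :
    3 * momentDet M (some r) (some r) (some r') (some r') =
      M 2 ^ 2 * wick (Fintype.card ι) ((1 - C 2 * X) * rowPoly M ^ (Fintype.card ι - 2)) := by
  have hT : momentDet M (some r) (some r) (some r') (some r') = mixedDet (Function.update
      (Function.update (fun _ => rowT (rowPoly M)) r fun j => M 2 * if j 2 = j 3 then 1 else 0) r'
      fun j => M 2 * if j 0 = j 1 then 1 else 0) := by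
    rw [momentDet]
    congr 1
    funext i
    by_cases hi : i = r
    · subst hi
      rw [Function.update_of_ne h, Function.update_self, ← momT_pair h0 h1 (by decide)]
      congr 1
      ext l
      fin_cases l <;> simp [Ne.symm h]
    by_cases hi' : i = r'
    · subst hi'
      rw [Function.update_self, ← momT_pair h0 h1 (by decide)]
      congr 1
      ext l
      fin_cases l <;> simp [h]
    · rw [Function.update_of_ne hi', Function.update_of_ne hi, ← momT_univ_eq_rowPoly h0 h1]
      congr 1
      ext l
      fin_cases l <;> simp [Ne.symm hi, Ne.symm hi']
  have hpaired (i : ι) (_ : i ≠ r) (j : Fin 4 → ι) (hj : Function.update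
      (fun _ => rowT (rowPoly M)) r' (linkT (some 0)) i j ≠ 0) : Paired j := by
    by_cases hi : i = r'
    · rw [hi, Function.update_self] at hj
      by_contra hn
      exact hj (if_neg fun hl => hn ⟨0, hl⟩)
    · rw [Function.update_of_ne hi] at hj
      exact paired_of_rowT_ne_zero hj
  rw [hT, mixedDet_update_smul, Function.update_comm h, mixedDet_update_smul,
    Function.update_comm h.symm, mixedDet_swap_rows _ h, Function.update_comm h,
    mixedDet_free_row hpaired, Function.update_comm h.symm, update_rowT, mul_left_comm,
    mul_left_comm 3, mixedDet_linkT_row,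
    mixedDet_two_special M h (by compute_degree) (by simp), one_mul]
  ring

end Patterns

end RandomDet

namespace RandomDet

open Finset Polynomial

/-! ### Comparison with the closed formula -/

section ClosedForm

/-- The number of ordered choices of `k + e` special rows, times the mixed determinant with `k`
special diagonal rows and `e` special Gaussian rows. -/
noncomputable def specialSum (M : ℕ → ℝ) (n k e : ℕ) : ℝ :=
  n.descFactorial (k + e) * wick n (X ^ k * rowPoly M ^ (n - (k + e)))

/-- The contribution to `specialSum` of `N` rows that are not diagonal. -/
noncomputable def specialTerm (s : ℝ) (k e N : ℕ) : ℝ :=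
  if k + e ≤ N then ((N - k).descFactorial e * (N - k + 2).choose 2 : ℕ) / (s ^ 2) ^ (k + e) else 0

lemma wick_X_pow_mul_rowPoly_pow (M : ℕ → ℝ) (n k m : ℕ) :
    wick n (X ^ k * rowPoly M ^ m) = ∑ j ∈ range (m + 1),
      m.choose j * (M 4 - 3 * M 2 ^ 2) ^ j * (M 2 ^ 2) ^ (m - j) * wickValue n (k + j) := by
  rw [rowPoly, add_comm, add_pow, mul_sum, map_sum]
  refine sum_congr rfl fun j _ => ?_
  rw [← wick_C_mul_X_pow]
  congr 1
  rw [mul_pow, ← C_pow, ← C_pow, pow_add, C_mul, C_mul, C_eq_natCast]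
  ring

lemma specialSum_eq (M : ℕ → ℝ) (h2 : M 2 ≠ 0) (n k e : ℕ) :
    specialSum M n k e = (n.factorial : ℝ) ^ 2 * M 2 ^ (2 * n) * ∑ j ∈ range (n + 1),
      1 / (j.factorial : ℝ) * (M 4 / M 2 ^ 2 - 3) ^ j * specialTerm (M 2) k e (n - j) := by
  have hpos (j : ℕ) : (j.factorial : ℝ) ≠ 0 := by positivity
  rw [specialSum]
  by_cases hn : k + e ≤ n
  · obtain ⟨m, rfl⟩ := Nat.exists_eq_add_of_le' hn
    rw [Nat.add_sub_cancel, wick_X_pow_mul_rowPoly_pow, mul_sum, mul_sum]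
    refine sum_subset_zero_on_sdiff (range_subset_range.2 (by omega)) (fun j hj => ?_)
      fun j hj => ?_
    · rw [mem_sdiff, mem_range, mem_range] at hj
      rw [specialTerm, if_neg (by omega), mul_zero, mul_zero]
    -- Here `j` ordinary rows are diagonal and `p` are Gaussian, so `N - k = p + e` counts all
    -- Gaussian rows, the special ones included.
    · obtain ⟨p, rfl⟩ := Nat.exists_eq_add_of_le' (Nat.lt_succ_iff.1 (mem_range.1 hj))
      rw [specialTerm, if_pos (by omega), wickValue,
        show p + j + (k + e) - j - k = p + e by omega,
        show p + j + (k + e) - (k + j) = p + e by omega, Nat.add_sub_cancel]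
      have e1 : ((p + j).factorial : ℝ) * (p + j + (k + e)).descFactorial (k + e) =
          (p + j + (k + e)).factorial := by
        have := Nat.factorial_mul_descFactorial (Nat.le_add_left (k + e) (p + j))
        rw [Nat.add_sub_cancel] at this
        exact_mod_cast this
      have e2 : ((p + j).choose j : ℝ) * p.factorial * j.factorial = (p + j).factorial := by
        have := Nat.add_choose_mul_factorial_mul_factorial p j
        exact_mod_cast this
      have e3 : (p.factorial : ℝ) * (p + e).descFactorial e = (p + e).factorial := by
        have := Nat.factorial_mul_descFactorial (Nat.le_add_left e p)
        rw [Nat.add_sub_cancel] at this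
        exact_mod_cast this
      have e4 : (M 4 - 3 * M 2 ^ 2) ^ j = (M 4 / M 2 ^ 2 - 3) ^ j * (M 2 ^ 2) ^ j := by
        rw [← mul_pow]
        congr 1
        field_simp
      have e5 : M 2 ^ (2 * (p + j + (k + e))) =
          (M 2 ^ 2) ^ p * (M 2 ^ 2) ^ j * (M 2 ^ 2) ^ (k + e) := by
        rw [pow_mul, pow_add, pow_add]
      rw [e4, e5, ← e3]
      have hF : ((p + j + (k + e)).descFactorial (k + e) : ℝ) * (p + j).choose j * p.factorial =
          (p + j + (k + e)).factorial / j.factorial := by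
        rw [← e1, ← e2]
        field_simp
      push_cast
      have hs : (M 2 ^ 2) ^ (k + e) ≠ 0 := by positivity
      calc _ = (((p + j + (k + e)).descFactorial (k + e) : ℝ) * (p + j).choose j * p.factorial) *
            ((M 4 / M 2 ^ 2 - 3) ^ j * (M 2 ^ 2) ^ j * (M 2 ^ 2) ^ p * (p + j + (k + e)).factorial *
              (p + e).descFactorial e * (p + e + 2).choose 2) := by ring
        _ = _ := by
          rw [hF]
          field_simp
  · rw [Nat.descFactorial_of_lt (by omega), Nat.cast_zero, zero_mul, sum_eq_zero, mul_zero]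
    intro j hj
    rw [specialTerm, if_neg (by omega), mul_zero]

lemma cast_choose_add_one (N : ℕ) : ((N + 1).choose 1 : ℝ) = N + 1 := by simp

lemma cast_choose_add_two (N : ℕ) : ((N + 2).choose 2 : ℝ) = (N + 2) * (N + 1) / 2 := by
  have h : ((N + 2).descFactorial 2 : ℝ) = (Nat.factorial 2 : ℕ) * (N + 2).choose 2 := by
    exact_mod_cast Nat.descFactorial_eq_factorial_mul_choose (N + 2) 2
  simp [Nat.descFactorial, Nat.factorial] at h
  linarith

lemma cast_choose_add_three (N : ℕ) :
    ((N + 3).choose 3 : ℝ) = (N + 3) * (N + 2) * (N + 1) / 6 := by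
  have h : ((N + 3).descFactorial 3 : ℝ) = (Nat.factorial 3 : ℕ) * (N + 3).choose 3 := by
    exact_mod_cast Nat.descFactorial_eq_factorial_mul_choose (N + 3) 3
  simp [Nat.descFactorial, Nat.factorial] at h
  linarith

lemma cast_choose_add_four (N : ℕ) :
    ((N + 4).choose 4 : ℝ) = (N + 4) * (N + 3) * (N + 2) * (N + 1) / 24 := by
  have h : ((N + 4).descFactorial 4 : ℝ) = (Nat.factorial 4 : ℕ) * (N + 4).choose 4 := by
    exact_mod_cast Nat.descFactorial_eq_factorial_mul_choose (N + 4) 4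
  simp [Nat.descFactorial, Nat.factorial] at h
  linarith

lemma binom_natCast_add (N i : ℕ) : binom ((N : ℤ) + (i : ℤ)) i = ((N + i).choose i : ℕ) := by
  rw [binom, if_pos (Int.natCast_nonneg i), Int.toNat_natCast, ← Nat.cast_add,
    Ring.choose_natCast]

lemma sum_qCoeff_mul_binom (a s c : ℝ) (N : ℕ) :
    ∑ i ∈ Icc (-2 : ℤ) 4, qCoeff a s c i * (binom ((N : ℤ) + i) i : ℝ) =
      qCoeff a s c (-2) * (if N = 0 then 1 else if N = 1 then -1 else 0) +
      qCoeff a s c (-1) * (if N = 0 then 1 else 0) + qCoeff a s c 0 +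
      qCoeff a s c 1 * (N + 1) + qCoeff a s c 2 * ((N + 2) * (N + 1) / 2) +
      qCoeff a s c 3 * ((N + 3) * (N + 2) * (N + 1) / 6) +
      qCoeff a s c 4 * ((N + 4) * (N + 3) * (N + 2) * (N + 1) / 24) := by
  have hI : Icc (-2 : ℤ) 4 = {-2, -1, ((0 : ℕ) : ℤ), ((1 : ℕ) : ℤ), ((2 : ℕ) : ℤ),
      ((3 : ℕ) : ℤ), ((4 : ℕ) : ℤ)} := by decide
  have hm2 : (binom ((N : ℤ) + -2) (-2) : ℝ) =
      if N = 0 then 1 else if N = 1 then -1 else 0 := by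
    rw [binom]
    split_ifs <;> first | omega | simp
  have hm1 : (binom ((N : ℤ) + -1) (-1) : ℝ) = if N = 0 then 1 else 0 := by
    rw [binom]
    split_ifs <;> first | omega | simp
  rw [hI]
  rw [sum_insert (by decide), sum_insert (by decide), sum_insert (by decide),
    sum_insert (by decide), sum_insert (by decide), sum_insert (by decide), sum_singleton,
    hm2, hm1, binom_natCast_add, binom_natCast_add, binom_natCast_add, binom_natCast_add,
    binom_natCast_add]
  simp only [Int.cast_natCast, cast_choose_add_one, cast_choose_add_two, cast_choose_add_three,
    cast_choose_add_four, Nat.choose_zero_right]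
  push_cast
  ring

/-- The fourth moment of the determinant, organised by the special rows. -/
noncomputable def combine (a s c : ℝ) (U : ℕ → ℕ → ℝ) : ℝ :=
  U 0 0 + 4 * a * c * U 1 0 + 6 * a ^ 2 * (s / 3 * U 0 1 + c ^ 2 * U 2 0) +
    4 * a ^ 3 * (s * c * U 1 1 + c ^ 3 * U 3 0) +
    a ^ 4 * (U 0 1 - 2 * U 1 0 + s ^ 2 * (U 0 2 - 2 * U 1 1) + 2 * s * c ^ 2 * U 2 1 +
      c ^ 4 * U 4 0)

/-- For `N ≥ 4` no cutoff in `specialTerm` is active and this is an identity of polynomials in `N`.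
Continued below the cutoffs, those polynomials vanish except for `(k, e) = (3, 0)` at `N = 0` and
`(4, 0)` at `N = 0, 1`; the coefficients `q₋₁` and `q₋₂` correct exactly these values. -/
lemma combine_specialTerm (a s c : ℝ) (hs : s ≠ 0) (N : ℕ) :
    combine a s c (fun k e => specialTerm s k e N) =
      ∑ i ∈ Icc (-2 : ℤ) 4, qCoeff a s c i * (binom ((N : ℤ) + i) i : ℝ) := by
  rw [sum_qCoeff_mul_binom]
  match N with
  | 0 =>
    simp [combine, specialTerm, qCoeff]
    field_simp
    ring
  | 1 =>
    simp [combine, specialTerm, qCoeff, Nat.choose]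
    field_simp
    ring
  | 2 =>
    simp [combine, specialTerm, qCoeff, Nat.choose, Nat.descFactorial]
    field_simp
    ring
  | 3 =>
    simp [combine, specialTerm, qCoeff, Nat.choose, Nat.descFactorial]
    field_simp
    ring
  | K + 4 =>
    have h2 := cast_choose_add_two
    simp only [combine, specialTerm, qCoeff]
    rw [if_pos (by omega), if_pos (by omega), if_pos (by omega), if_pos (by omega),
      if_pos (by omega), if_pos (by omega), if_pos (by omega), if_pos (by omega),
      if_pos (by omega), if_neg (by omega), if_neg (by omega), if_neg (by omega)]
    simp only [Nat.sub_zero, show K + 4 - 1 = K + 3 by omega, show K + 4 - 2 = K + 2 by omega,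
      show K + 4 - 3 = K + 1 by omega, show K + 4 - 4 = K by omega, Nat.cast_mul,
      cast_choose_add_two, Nat.descFactorial]
    push_cast
    field_simp
    ring

lemma sum_combine (a s c : ℝ) (n : ℕ) (w : ℕ → ℝ) (A : ℝ) (U : ℕ → ℕ → ℕ → ℝ) :
    combine a s c (fun k e => A * ∑ j ∈ range n, w j * U k e j) =
      A * ∑ j ∈ range n, w j * combine a s c fun k e => U k e j := by
  induction n with
  | zero => simp [combine]
  | succ n ih =>
    simp only [sum_range_succ, combine] at ih ⊢
    linear_combination ih

lemma closedForm_eq_combine (M m : ℕ → ℝ) (h2 : M 2 = mu2 m) (h3 : M 3 = mu3 m)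
    (h4 : M 4 = mu4 m) (hm : mu2 m ≠ 0) (n : ℕ) :
    closedForm m n = combine (m 1) (M 2) (M 3) (specialSum M n) := by
  have hs : M 2 ≠ 0 := h2 ▸ hm
  have hU : specialSum M n = fun k e => (n.factorial : ℝ) ^ 2 * M 2 ^ (2 * n) *
      ∑ j ∈ range (n + 1), 1 / (j.factorial : ℝ) * (M 4 / M 2 ^ 2 - 3) ^ j *
        specialTerm (M 2) k e (n - j) :=
    funext fun k => funext fun e => specialSum_eq M hs n k e
  rw [hU, sum_combine, closedForm, h2, h3, h4]
  congr 1
  refine sum_congr rfl fun j hj => ?_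
  rw [combine_specialTerm _ _ _ hm, Nat.cast_sub (Nat.lt_succ_iff.1 (mem_range.1 hj))]

end ClosedForm

end RandomDet

namespace RandomDet

open Finset Polynomial

/-! ### Sums over row positions, by coincidence pattern -/

section PatternSums

variable {ι : Type*} [Fintype ι] [DecidableEq ι]

lemma sum_eq_of_forall_notMem (S : Finset ι) {g : ι → ℝ} {y : ℝ} (h : ∀ b, b ∉ S → g b = y) :
    ∑ b, g b = ∑ b ∈ S, g b + (Fintype.card ι - #S) * y := by
  rw [← sum_add_sum_compl S g, sum_congr rfl fun b hb => h b (mem_compl.1 hb), sum_const,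
    card_compl, nsmul_eq_mul, Nat.cast_sub (card_le_univ S)]

lemma sum_two_pattern {f : ι → ι → ℝ} {x y : ℝ} (hx : ∀ a, f a a = x)
    (hy : ∀ a b, a ≠ b → f a b = y) :
    ∑ a, ∑ b, f a b = (Fintype.card ι).descFactorial 1 * x +
      (Fintype.card ι).descFactorial 2 * y := by
  have h (a : ι) : ∑ b, f a b = x + (Fintype.card ι - 1) * y := by
    rw [sum_eq_of_forall_notMem {a} (y := y) fun b hb => hy a b (by simpa [eq_comm] using hb)]
    simp [hx]
  simp_rw [h, sum_const, card_univ, nsmul_eq_mul, Nat.cast_descFactorial_two,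
    Nat.descFactorial_one]
  ring

lemma cast_descFactorial_succ (n k : ℕ) :
    (n.descFactorial (k + 1) : ℝ) = (n - k) * n.descFactorial k := by
  rw [Nat.descFactorial_succ]
  rcases le_or_gt k n with h | h
  · rw [Nat.cast_mul, Nat.cast_sub h]
  · simp [Nat.descFactorial_of_lt h]

lemma sum_three_pattern {f : ι → ι → ι → ℝ} {x y z : ℝ} (hx : ∀ a, f a a a = x)
    (hy : ∀ a b, a ≠ b → f a a b = y) (hy' : ∀ a b, a ≠ b → f a b a = y)
    (hy'' : ∀ a b, a ≠ b → f b a a = y)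
    (hz : ∀ a b c, a ≠ b → a ≠ c → b ≠ c → f a b c = z) :
    ∑ a, ∑ b, ∑ c, f a b c = (Fintype.card ι).descFactorial 1 * x +
      3 * (Fintype.card ι).descFactorial 2 * y + (Fintype.card ι).descFactorial 3 * z := by
  rw [sum_two_pattern (f := fun a b => ∑ c, f a b c) (x := x + (Fintype.card ι - 1) * y)
    (y := 2 * y + (Fintype.card ι - 2) * z)]
  · simp only [cast_descFactorial_succ, Nat.descFactorial_zero]
    push_cast
    ring
  · intro a
    rw [sum_eq_of_forall_notMem {a} (y := y) fun c hc => hy a c (by simpa [eq_comm] using hc)]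
    simp [hx]
  · intro a b hab
    rw [sum_eq_of_forall_notMem {a, b} (y := z) fun c hc => ?_, sum_pair hab, card_pair hab,
      hy' a b hab, hy'' b a hab.symm]
    · push_cast
      ring
    · simp only [mem_insert, mem_singleton, not_or] at hc
      exact hz a b c hab (Ne.symm hc.1) (Ne.symm hc.2)

/-- The coefficients `1, 3, 6, 1` count the set partitions of four positions of types 4, 2+2, 2+1+1
and 1+1+1+1; the type 3+1 drops out by `h0`. -/
lemma sum_four_pattern {f : ι → ι → ι → ι → ℝ} {x y z t : ℝ}
    (s12 : ∀ a b c d, f a b c d = f b a c d) (s23 : ∀ a b c d, f a b c d = f a c b d)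
    (s34 : ∀ a b c d, f a b c d = f a b d c) (hx : ∀ a, f a a a a = x)
    (h0 : ∀ a b, a ≠ b → f a a a b = 0) (hy : ∀ a b, a ≠ b → f a a b b = y)
    (hz : ∀ a b c, a ≠ b → a ≠ c → b ≠ c → f a a b c = z)
    (ht : ∀ a b c d, a ≠ b → a ≠ c → a ≠ d → b ≠ c → b ≠ d → c ≠ d → f a b c d = t) :
    ∑ a, ∑ b, ∑ c, ∑ d, f a b c d = (Fintype.card ι).descFactorial 1 * x +
      3 * (Fintype.card ι).descFactorial 2 * y + 6 * (Fintype.card ι).descFactorial 3 * z +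
      (Fintype.card ι).descFactorial 4 * t := by
  have hrow (a b : ι) (hab : a ≠ b) : ∑ d, f a a b d = y + (Fintype.card ι - 2) * z := by
    rw [sum_eq_of_forall_notMem {a, b} (y := z) fun c hc => ?_, sum_pair hab, card_pair hab,
      s34, h0 a b hab, hy a b hab]
    · push_cast
      ring
    · simp only [mem_insert, mem_singleton, not_or] at hc
      exact hz a b c hab (Ne.symm hc.1) (Ne.symm hc.2)
  rw [sum_three_pattern (f := fun a b c => ∑ d, f a b c d) (x := x)
    (y := y + (Fintype.card ι - 2) * z) (z := 3 * z + (Fintype.card ι - 3) * t)]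
  · simp only [cast_descFactorial_succ, Nat.descFactorial_zero]
    push_cast
    ring
  · intro a
    rw [sum_eq_of_forall_notMem {a} (y := 0) fun c hc => h0 a c (by simpa [eq_comm] using hc)]
    simp [hx]
  · exact hrow
  · intro a b hab
    rw [← hrow a b hab]
    exact sum_congr rfl fun d _ => s23 a b a d
  · intro a b hab
    rw [← hrow a b hab]
    exact sum_congr rfl fun d _ => by rw [s12, s23]
  -- A fourth index either repeats one of `a`, `b`, `c`, each giving `z` after reordering, or is
  -- new.
  · intro a b c hab hac hbc
    have hcard : #{a, b, c} = 3 := card_eq_three.2 ⟨a, b, c, hab, hac, hbc, rfl⟩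
    rw [sum_eq_of_forall_notMem {a, b, c} (y := t) fun d hd => ?_, hcard,
      sum_insert (by simp [hab, hac]), sum_pair hbc, s34 a b c a, s23 a b a c,
      hz a b c hab hac hbc, s34 a b c b, s12 a b b c, s23 b a b c, hz b a c hab.symm hbc hac,
      s12 a b c c, s23 b a c c, s12 b c a c, s34 c b a c, s23 c b c a,
      hz c b a hbc.symm hac.symm hab.symm]
    · push_cast
      ring
    · simp only [mem_insert, mem_singleton, not_or] at hd
      exact ht a b c d hab hac (Ne.symm hd.1) hbc (Ne.symm hd.2.1) (Ne.symm hd.2.2)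

/-- The sums of `momentDet` over the positions of the rows replaced by ones. -/
lemma sum_momentDet {M : ℕ → ℝ} (h0 : M 0 = 1) (h1 : M 1 = 0)
    (s12 : ∀ a b c d : Option ι, momentDet M a b c d = momentDet M b a c d)
    (s23 : ∀ a b c d : Option ι, momentDet M a b c d = momentDet M a c b d)
    (s34 : ∀ a b c d : Option ι, momentDet M a b c d = momentDet M a b d c) (m : ℝ) :
    momentDet (ι := ι) M none none none none +
      4 * m * ∑ a : ι, momentDet M (some a) none none none +
      6 * m ^ 2 * ∑ a : ι, ∑ b : ι, momentDet M (some a) (some b) none none +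
      4 * m ^ 3 * ∑ a : ι, ∑ b : ι, ∑ c : ι, momentDet M (some a) (some b) (some c) none +
      m ^ 4 * ∑ a : ι, ∑ b : ι, ∑ c : ι, ∑ d : ι,
        momentDet M (some a) (some b) (some c) (some d) =
      combine m (M 2) (M 3) (specialSum M (Fintype.card ι)) := by
  have third {u v : ℝ} (h : 3 * u = v) : u = v / 3 := by linarith
  have hsub (p q : ℝ[X]) (n : ℕ) :
      wick n ((1 - C 2 * p) * q) = wick n q - 2 * wick n (p * q) := by
    rw [sub_mul, one_mul, map_sub, mul_assoc, ← smul_eq_C_mul, map_smul, smul_eq_mul]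
  rw [momentDet_none h0 h1, sum_congr rfl fun a _ => momentDet_one h0 h1 a, sum_const, card_univ,
    nsmul_eq_mul,
    sum_two_pattern (fun a => third (momentDet_two h0 h1 a))
      (fun a b hab => momentDet_one_one h0 h1 hab),
    sum_three_pattern (fun a => momentDet_three h1 a)
      (fun a b hab => third (momentDet_two_one h0 h1 hab))
      (fun a b hab => by rw [s23]; exact third (momentDet_two_one h0 h1 hab))
      (fun a b hab => by rw [s12, s23]; exact third (momentDet_two_one h0 h1 hab))
      (fun a b c hab hac hbc => momentDet_one_one_one h0 h1 hab hac hbc),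
    sum_four_pattern (f := fun a b c d : ι => momentDet M (some a) (some b) (some c) (some d))
      (fun a b c d => s12 _ _ _ _) (fun a b c d => s23 _ _ _ _) (fun a b c d => s34 _ _ _ _)
      (fun a => momentDet_four h0 h1 a)
      (fun a b hab => momentDet_three_one h1 hab)
      (fun a b hab => third (momentDet_two_two h0 h1 hab))
      (fun a b c hab hac hbc => third (momentDet_two_one_one h0 h1 hab hac hbc))
      (fun a b c d hab hac had hbc hbd hcd =>
        momentDet_one_one_one_one h0 h1 hab hac had hbc hbd hcd)]
  simp only [combine, specialSum, hsub, Nat.add_zero, Nat.zero_add, pow_zero, pow_one, one_mul,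
    Nat.reduceAdd, Nat.descFactorial_zero, Nat.descFactorial_one, Nat.sub_zero, Nat.cast_one]
  ring

end PatternSums

/-! ### Adding a constant to all entries -/

section Determinant

variable {ι : Type*} [Fintype ι] [DecidableEq ι]

/-- The constant is added to one row at a time. In the determinant with row `r` equal to ones, the
constants already added to other rows are removed by subtracting multiples of row `r`. -/
lemma det_add_const (Y : Matrix ι ι ℝ) (a : ℝ) :
    (Matrix.of fun i j => Y i j + a).det =
      Y.det + a * ∑ r, (Y.updateRow r fun _ => 1).det := by
  have key (s : Finset ι) : (Matrix.of fun i j => Y i j + if i ∈ s then a else 0).det =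
      Y.det + a * ∑ r ∈ s, (Y.updateRow r fun _ => 1).det := by
    induction s using Finset.induction_on with
    | empty => simp [show (Matrix.of fun i j => Y i j) = Y from rfl]
    | insert r s hr ih =>
      set A := Matrix.of fun i j => Y i j + if i ∈ s then a else 0 with hA
      have h1 : (Matrix.of fun i j => Y i j + if i ∈ insert r s then a else 0) =
          A.updateRow r (A r + a • fun _ => 1) := by
        ext i j
        by_cases hi : i = r
        · subst hi
          simp [hA, hr]
        · simp [hA, hi]
      have h2 : (A.updateRow r fun _ => 1).det = (Y.updateRow r fun _ => 1).det := by
        refine Matrix.det_eq_of_forall_row_eq_smul_add_const (fun i => if i ∈ s then a else 0) r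
          (by simp [hr]) fun i j => ?_
        by_cases hi : i = r
        · subst hi
          simp [hr]
        · simp [hA, hi]
      rw [h1, Matrix.det_updateRow_add, Matrix.det_updateRow_smul, Matrix.updateRow_eq_self, ih,
        h2, sum_insert hr]
      ring
  simpa using key univ

end Determinant

end RandomDet

namespace RandomDet

open Equiv Finset

/-! ### Central moments and integrability -/

section CentralMoments

variable {ν : Measure ℝ} [IsProbabilityMeasure ν]

lemma integrable_sub_pow (hν : Integrable (fun x : ℝ => x ^ 4) ν) (a : ℝ) {k : ℕ} (hk : k ≤ 4) :
    Integrable (fun x : ℝ => (x - a) ^ k) ν := by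
  -- The bound comes from `|t| ^ k ≤ 1 + t ^ 4` for `k ≤ 4` and `(x - a) ^ 4 ≤ 8 * (x ^ 4 + a ^ 4)`.
  refine Integrable.mono' (g := fun x => (1 + 8 * a ^ 4) + 8 * x ^ 4)
    ((integrable_const _).add (hν.const_mul 8)) (by fun_prop) (.of_forall fun x => ?_)
  have h1 : |x - a| ^ k ≤ 1 + |x - a| ^ 4 := by
    rcases le_total |x - a| 1 with h | h
    · linarith [pow_le_one₀ (n := k) (abs_nonneg _) h, pow_nonneg (abs_nonneg (x - a)) 4]
    · linarith [pow_le_pow_right₀ h hk]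
  have h2 : |x - a| ^ 4 = (x - a) ^ 4 := Even.pow_abs (by decide) _
  rw [Real.norm_eq_abs, abs_pow]
  nlinarith [sq_nonneg (x + a), sq_nonneg (x - a), sq_nonneg (x ^ 2 - a ^ 2), sq_nonneg (x * a),
    mul_nonneg (sq_nonneg (x + a)) (sq_nonneg (x + a)),
    mul_nonneg (sq_nonneg (x + a)) (sq_nonneg (x - a))]

variable {m : ℕ → ℝ}

lemma integral_central_moments (hν : Integrable (fun x : ℝ => x ^ 4) ν)
    (hm : ∀ r : ℕ, m r = ∫ x, x ^ r ∂ν) :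
    (∫ x, (x - m 1) ^ 0 ∂ν = 1) ∧ (∫ x, (x - m 1) ^ 1 ∂ν = 0) ∧
      (∫ x, (x - m 1) ^ 2 ∂ν = mu2 m) ∧ (∫ x, (x - m 1) ^ 3 ∂ν = mu3 m) ∧
      (∫ x, (x - m 1) ^ 4 ∂ν = mu4 m) := by
  have hi {k : ℕ} (hk : k ≤ 4) : Integrable (fun x : ℝ => x ^ k) ν := by
    simpa using integrable_sub_pow hν 0 hk
  have hm0 : m 0 = 1 := by simp [hm 0]
  have key (k : ℕ) (hk : k ≤ 4) (a : ℝ) : ∫ x, (x - a) ^ k ∂ν =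
      ∑ i ∈ range (k + 1), m i * (-a) ^ (k - i) * k.choose i := by
    simp_rw [sub_eq_add_neg, add_pow]
    rw [integral_finsetSum]
    · refine sum_congr rfl fun i _ => ?_
      rw [integral_mul_const, integral_mul_const, hm i]
    · intro i hmem
      rw [mem_range] at hmem
      exact ((hi (by omega)).mul_const _).mul_const _
  refine ⟨by simp, ?_, ?_, ?_, ?_⟩
  · rw [key 1 (by norm_num)]
    simp [sum_range_succ, hm0]
  · rw [key 2 (by norm_num)]
    simp [sum_range_succ, hm0, mu2]
    ring
  · rw [key 3 (by norm_num)]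
    simp [sum_range_succ, hm0, mu3, Nat.choose]
    ring
  · rw [key 4 (by norm_num)]
    simp [sum_range_succ, hm0, mu4, Nat.choose]
    ring

end CentralMoments

/-! ### Expectation of products of four determinants -/

section Expectation

variable {Ω : Type*} [MeasurableSpace Ω] {P : Measure Ω} [IsProbabilityMeasure P]

lemma integrable_prod_of_iIndepFun {κ : Type*} [Fintype κ] {ν : Measure ℝ}
    [IsProbabilityMeasure ν] {X : κ → Ω → ℝ} (hX : ∀ p, HasLaw (X p) ν P)
    (hindep : iIndepFun X P) {f : κ → ℝ → ℝ} (hf : ∀ p, Integrable (f p) ν) :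
    Integrable (fun ω => ∏ p, f p (X p ω)) P := by
  have hmap := (iIndepFun_iff_map_fun_eq_pi_map fun p => (hX p).aemeasurable).1 hindep
  have hpi : Integrable (fun x : κ → ℝ => ∏ p, f p (x p))
      (P.map fun ω p => X p ω) := by
    rw [hmap]
    have hl (p : κ) : P.map (X p) = ν := (hX p).map_eq
    simp_rw [hl]
    exact Integrable.fintype_prod hf
  exact hpi.comp_aemeasurable (aemeasurable_pi_lambda _ fun p => (hX p).aemeasurable)

variable {ι : Type*} [Fintype ι] [DecidableEq ι]

/-- The matrix `Y`, with the row indicated by `o` (if any) replaced by ones. -/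
def onesRow (Y : ι → ι → ℝ) (o : Option ι) : Matrix ι ι ℝ :=
  Matrix.of fun i j => if o = some i then 1 else Y i j

/-- Grouping equal entries turns each monomial into a product of powers of distinct, hence
independent, entries; the exponents are those occurring in `momT`. -/
lemma prod_onesRow (Y : ι → ι → ℝ) (o : Fin 4 → Option ι) (σ : Fin 4 → Perm ι) :
    ∏ i, ∏ l, onesRow Y (o l) i (σ l i) =
      ∏ p : ι × ι, Y p.1 p.2 ^ #{l ∈ ({l | o l ≠ some p.1} : Finset (Fin 4)) | σ l p.1 = p.2} := by
  rw [Fintype.prod_prod_type]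
  refine prod_congr rfl fun i _ => ?_
  rw [prod_congr rfl fun l _ => show onesRow Y (o l) i (σ l i) =
    if o l ≠ some i then Y i (σ l i) else 1 by simp [onesRow, ite_not], ← prod_filter,
    ← prod_fiberwise _ fun l => σ l i]
  refine prod_congr rfl fun k _ => ?_
  rw [prod_congr rfl fun l hl => by rw [(mem_filter.1 hl).2], prod_const]

variable {ν : Measure ℝ} [IsProbabilityMeasure ν] {X : ι → ι → Ω → ℝ}

omit [DecidableEq ι] in
lemma integrable_integral_prod_pow (hν : Integrable (fun x : ℝ => x ^ 4) ν)
    (hlaw : ∀ i j, HasLaw (X i j) ν P) (hindep : iIndepFun (fun p : ι × ι => X p.1 p.2) P)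
    (a : ℝ) {e : ι × ι → ℕ} (he : ∀ p, e p ≤ 4) :
    Integrable (fun ω => ∏ p, (X p.1 p.2 ω - a) ^ e p) P ∧
      ∫ ω, ∏ p, (X p.1 p.2 ω - a) ^ e p ∂P = ∏ p, ∫ x, (x - a) ^ e p ∂ν := by
  refine ⟨integrable_prod_of_iIndepFun (fun p : ι × ι => hlaw p.1 p.2) hindep
    (f := fun p x => (x - a) ^ e p) fun p => integrable_sub_pow hν a (he p), ?_⟩
  rw [hindep.integral_fun_prod_comp (f := fun p x => (x - a) ^ e p)
    (fun p => (hlaw p.1 p.2).aemeasurable) (fun p => by fun_prop)]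
  refine prod_congr rfl fun p _ => ?_
  exact (hlaw p.1 p.2).integral_comp (f := fun x => (x - a) ^ e p) (by fun_prop)

lemma integrable_integral_prod_det (hν : Integrable (fun x : ℝ => x ^ 4) ν)
    (hlaw : ∀ i j, HasLaw (X i j) ν P) (hindep : iIndepFun (fun p : ι × ι => X p.1 p.2) P)
    (a : ℝ) (o : Fin 4 → Option ι) :
    Integrable (fun ω => ∏ l, (onesRow (fun i j => X i j ω - a) (o l)).det) P ∧
      ∫ ω, ∏ l, (onesRow (fun i j => X i j ω - a) (o l)).det ∂P =
        mixedDet fun i => momT (fun k => ∫ x, (x - a) ^ k ∂ν) {l | o l ≠ some i} := by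
  let e (σ : Fin 4 → Perm ι) (p : ι × ι) : ℕ :=
    #{l ∈ ({l | o l ≠ some p.1} : Finset (Fin 4)) | σ l p.1 = p.2}
  have he (σ : Fin 4 → Perm ι) (p : ι × ι) : e σ p ≤ 4 :=
    (card_le_univ _).trans_eq (Fintype.card_fin 4)
  have hexp (ω : Ω) : ∏ l, (onesRow (fun i j => X i j ω - a) (o l)).det =
      ∑ σ : Fin 4 → Perm ι, (∏ l, ((Perm.sign (σ l) : ℤ) : ℝ)) *
        ∏ p : ι × ι, (X p.1 p.2 ω - a) ^ e σ p := by
    rw [prod_det_eq_mixedDet, mixedDet]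
    exact sum_congr rfl fun σ _ => congrArg _ (prod_onesRow _ o σ)
  have hmom (σ : Fin 4 → Perm ι) :
      ∏ i, momT (fun k => ∫ x, (x - a) ^ k ∂ν) {l | o l ≠ some i} (fun l => σ l i) =
        ∏ p, ∫ x, (x - a) ^ e σ p ∂ν := by
    rw [Fintype.prod_prod_type]
    rfl
  have hint (σ : Fin 4 → Perm ι) := integrable_integral_prod_pow hν hlaw hindep a (he σ)
  clear_value e
  simp_rw [hexp, mixedDet, hmom]
  refine ⟨integrable_finsetSum _ fun σ _ => (hint σ).1.const_mul _, ?_⟩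
  rw [integral_finsetSum _ fun σ _ => (hint σ).1.const_mul _]
  exact sum_congr rfl fun σ _ => by rw [integral_const_mul, (hint σ).2]

/-- Expansion of the fourth power of the determinant along the rows replaced by ones. -/
lemma integrable_integral_det_pow_four (hν : Integrable (fun x : ℝ => x ^ 4) ν)
    (hlaw : ∀ i j, HasLaw (X i j) ν P) (hindep : iIndepFun (fun p : ι × ι => X p.1 p.2) P)
    {m : ℕ → ℝ} (hm : ∀ r : ℕ, m r = ∫ x, x ^ r ∂ν) :
    Integrable (fun ω => (Matrix.of fun i j => X i j ω).det ^ 4) P ∧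
      ∫ ω, (Matrix.of fun i j => X i j ω).det ^ 4 ∂P =
        combine (m 1) (mu2 m) (mu3 m)
          (specialSum (fun k => ∫ x, (x - m 1) ^ k ∂ν) (Fintype.card ι)) := by
  set M : ℕ → ℝ := fun k => ∫ x, (x - m 1) ^ k ∂ν with hM
  obtain ⟨h0, h1, h2, h3, -⟩ := integral_central_moments hν hm
  let D (o : Option ι) (ω : Ω) : ℝ := (onesRow (fun i j => X i j ω - m 1) o).det
  have hD (a b c d : Option ι) : Integrable (fun ω => D a ω * D b ω * D c ω * D d ω) P ∧
      ∫ ω, D a ω * D b ω * D c ω * D d ω ∂P = momentDet M a b c d := by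
    have := integrable_integral_prod_det hν hlaw hindep (m 1) ![a, b, c, d]
    simp only [Fin.prod_univ_four] at this
    exact this
  have hI (a b c d : Option ι) := (hD a b c d).1
  have hdet (ω : Ω) : (Matrix.of fun i j => X i j ω).det =
      D none ω + m 1 * ∑ r, D (some r) ω := by
    have := det_add_const (Matrix.of fun i j => X i j ω - m 1) (m 1)
    simp only [Matrix.of_apply, sub_add_cancel] at this
    have hn : D none ω = (Matrix.of fun i j => X i j ω - m 1).det := by simp [D, onesRow]
    have hs (r : ι) : D (some r) ω =
        ((Matrix.of fun i j => X i j ω - m 1).updateRow r fun _ => 1).det := by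
      refine congrArg Matrix.det ?_
      ext i j
      by_cases hi : i = r
      · subst hi
        simp [onesRow]
      · simp [onesRow, hi, Ne.symm hi]
    simp_rw [this, hn, hs]
  have hpow (ω : Ω) : (Matrix.of fun i j => X i j ω).det ^ 4 =
      D none ω * D none ω * D none ω * D none ω +
      4 * m 1 * ∑ a, D (some a) ω * D none ω * D none ω * D none ω +
      6 * m 1 ^ 2 * ∑ a, ∑ b, D (some a) ω * D (some b) ω * D none ω * D none ω +
      4 * m 1 ^ 3 * ∑ a, ∑ b, ∑ c, D (some a) ω * D (some b) ω * D (some c) ω * D none ω +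
      m 1 ^ 4 * ∑ a, ∑ b, ∑ c, ∑ d,
        D (some a) ω * D (some b) ω * D (some c) ω * D (some d) ω := by
    rw [hdet]
    simp only [← sum_mul, ← mul_sum]
    ring
  have i1 : Integrable (fun ω => ∑ a, D (some a) ω * D none ω * D none ω * D none ω) P :=
    integrable_finsetSum _ fun a _ => hI _ _ _ _
  have i2 : Integrable
      (fun ω => ∑ a, ∑ b, D (some a) ω * D (some b) ω * D none ω * D none ω) P :=
    integrable_finsetSum _ fun a _ => integrable_finsetSum _ fun b _ => hI _ _ _ _
  have i3 : Integrable (fun ω => ∑ a, ∑ b, ∑ c,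
      D (some a) ω * D (some b) ω * D (some c) ω * D none ω) P :=
    integrable_finsetSum _ fun a _ => integrable_finsetSum _ fun b _ =>
      integrable_finsetSum _ fun c _ => hI _ _ _ _
  have i4 : Integrable (fun ω => ∑ a, ∑ b, ∑ c, ∑ d,
      D (some a) ω * D (some b) ω * D (some c) ω * D (some d) ω) P :=
    integrable_finsetSum _ fun a _ => integrable_finsetSum _ fun b _ =>
      integrable_finsetSum _ fun c _ => integrable_finsetSum _ fun d _ => hI _ _ _ _
  have j0 := hI none none none none
  have j1 := i1.const_mul (4 * m 1)
  have j2 := i2.const_mul (6 * m 1 ^ 2)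
  have j3 := i3.const_mul (4 * m 1 ^ 3)
  have j4 := i4.const_mul (m 1 ^ 4)
  simp_rw [hpow]
  refine ⟨(((j0.add j1).add j2).add j3).add j4, ?_⟩
  have e1 : ∫ ω, ∑ a : ι, D (some a) ω * D none ω * D none ω * D none ω ∂P =
      ∑ a : ι, momentDet M (some a) none none none := by
    rw [integral_finsetSum _ fun a _ => hI _ _ _ _]
    exact sum_congr rfl fun a _ => (hD _ _ _ _).2
  have e2 : ∫ ω, ∑ a : ι, ∑ b : ι, D (some a) ω * D (some b) ω * D none ω * D none ω ∂P =
      ∑ a : ι, ∑ b : ι, momentDet M (some a) (some b) none none := by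
    rw [integral_finsetSum _ fun a _ => integrable_finsetSum _ fun b _ => hI _ _ _ _]
    refine sum_congr rfl fun a _ => ?_
    rw [integral_finsetSum _ fun b _ => hI _ _ _ _]
    exact sum_congr rfl fun b _ => (hD _ _ _ _).2
  have e3 : ∫ ω, ∑ a : ι, ∑ b : ι, ∑ c : ι, D (some a) ω * D (some b) ω * D (some c) ω * D none ω ∂P =
      ∑ a : ι, ∑ b : ι, ∑ c : ι, momentDet M (some a) (some b) (some c) none := by
    rw [integral_finsetSum _ fun a _ => integrable_finsetSum _ fun b _ =>
      integrable_finsetSum _ fun c _ => hI _ _ _ _]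
    refine sum_congr rfl fun a _ => ?_
    rw [integral_finsetSum _ fun b _ => integrable_finsetSum _ fun c _ => hI _ _ _ _]
    refine sum_congr rfl fun b _ => ?_
    rw [integral_finsetSum _ fun c _ => hI _ _ _ _]
    exact sum_congr rfl fun c _ => (hD _ _ _ _).2
  have e4 : ∫ ω, ∑ a : ι, ∑ b : ι, ∑ c : ι, ∑ d : ι,
      D (some a) ω * D (some b) ω * D (some c) ω * D (some d) ω ∂P =
      ∑ a : ι, ∑ b : ι, ∑ c : ι, ∑ d : ι, momentDet M (some a) (some b) (some c) (some d) := by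
    rw [integral_finsetSum _ fun a _ => integrable_finsetSum _ fun b _ =>
      integrable_finsetSum _ fun c _ => integrable_finsetSum _ fun d _ => hI _ _ _ _]
    refine sum_congr rfl fun a _ => ?_
    rw [integral_finsetSum _ fun b _ => integrable_finsetSum _ fun c _ =>
      integrable_finsetSum _ fun d _ => hI _ _ _ _]
    refine sum_congr rfl fun b _ => ?_
    rw [integral_finsetSum _ fun c _ => integrable_finsetSum _ fun d _ => hI _ _ _ _]
    refine sum_congr rfl fun c _ => ?_
    rw [integral_finsetSum _ fun d _ => hI _ _ _ _]
    exact sum_congr rfl fun d _ => (hD _ _ _ _).2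
  rw [integral_add (((j0.fun_add j1).fun_add j2).fun_add j3) j4,
    integral_add ((j0.fun_add j1).fun_add j2) j3, integral_add (j0.fun_add j1) j2, integral_add j0 j1,
    integral_const_mul, integral_const_mul,
    integral_const_mul, integral_const_mul, e1, e2, e3, e4, (hD none none none none).2,
    sum_momentDet (M := M) h0 h1, ← h2, ← h3]
  -- The symmetry of `momentDet` in its arguments is read off from the integrals, where the four
  -- factors commute.
  · intro a b c d
    rw [← (hD a b c d).2, ← (hD b a c d).2]
    exact integral_congr_ae (.of_forall fun ω => by ring)
  · intro a b c d
    rw [← (hD a b c d).2, ← (hD a c b d).2]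
    exact integral_congr_ae (.of_forall fun ω => by ring)
  · intro a b c d
    rw [← (hD a b c d).2, ← (hD a b d c).2]
    exact integral_congr_ae (.of_forall fun ω => by ring)

end Expectation

end RandomDet

theorem mainTheorem2
    {Ω : Type*} [MeasurableSpace Ω] (P : Measure Ω) [IsProbabilityMeasure P]
    (ν : Measure ℝ) [IsProbabilityMeasure ν]
    (hν4 : Integrable (fun x : ℝ => x ^ 4) ν)
    (m : ℕ → ℝ) (hm : ∀ r : ℕ, m r = ∫ x, x ^ r ∂ν)
    (hμ2 : RandomDet.mu2 m ≠ 0)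
    (n : ℕ) (X : Fin n → Fin n → Ω → ℝ)
    (hlaw : ∀ i j, HasLaw (X i j) ν P)
    (hindep : iIndepFun (fun p : Fin n × Fin n => X p.1 p.2) P) :
    Integrable (fun ω => (Matrix.of fun i j => X i j ω).det ^ 4) P ∧
      ∫ ω, (Matrix.of fun i j => X i j ω).det ^ 4 ∂P = RandomDet.closedForm m n := by
  obtain ⟨-, -, h2, h3, h4⟩ := RandomDet.integral_central_moments hν4 hm
  obtain ⟨hint, heq⟩ := RandomDet.integrable_integral_det_pow_four hν4 hlaw hindep hm
  refine ⟨hint, ?_⟩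
  rw [heq, Fintype.card_fin, RandomDet.closedForm_eq_combine
    (fun k => ∫ x, (x - m 1) ^ k ∂ν) m h2 h3 h4 hμ2]
  rw [h2, h3]
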